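/- Corollary 4.5 (genus one top-degree terms). For a partition $\lambda\vdash d$ let $\chi^\lambda_\mu$ be the value of the irreducible character of $S_d$ attached to $\lambda$ at permutations of cycle type $\mu$, and let $p_3(\lambda)=\sum_{i\ge 1}\big((\lambda_i-i+\tfrac12)^3-(-i+\tfrac12)^3\big)$. Let $n\ge 1$ be odd and put $s=\frac{n+1}{2}$. For positive integers $\beta_1,\dots,\beta_n$ with $d=\beta_1+\dots+\beta_n$, the genus-one one-part double Hurwitz number with completed $3$-cycles is $$H^{1,(2)}_{(d),\beta}=\frac{1}{d\,\beta_1\cdots\beta_n}\sum_{\lambda\vdash d}\chi^\lambda_{(d)}\Big(\frac{p_3(\lambda)}{3!}\Big)^{s}\chi^\lambda_{\beta}.$$ Then there is a unique polynomial in $\mathbb{Q}[\beta_1,\dots,\beta_n]$ whose value is $d\,H^{1,(2)}_{(d),\beta}/s!$ at all positive integers $\beta_1,\dots,\beta_n$. For integers $b_1,\dots,b_n\ge 0$ with $b_1+\dots+b_n=\frac{n+5}{2}$, let $\langle\langle\tau_{b_1}\cdots\tau_{b_n}\rangle\rangle_1$ be the coefficient of $\beta_1^{b_1}\cdots\beta_n^{b_n}$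 in this polynomial. Then $$\langle\langle\tau_{b_1}\cdots\tau_{b_n}\rangle\rangle_1=\frac{(n+1)!}{3\cdot 2^{\frac{n+7}{2}}\,\big(\frac{n+1}{2}\big)!}\left[\frac1n\binom{\frac{n+5}{2}}{b_1,\dots,b_n}+\sum_{i=1}^n\binom{\frac{n+1}{2}}{b_1,\dots,b_{i-1},b_i-2,b_{i+1},\dots,b_n}\right],$$ where the $i$-th multinomial coefficient in the sum is $0$ if $b_i<2$. -/

import Mathlib

open scoped Nat

noncomputable section

namespace CompletedHurwitz

/-- The Young diagram of a partition `lam` of `d`: its row lengths are the parts of `lam` in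
weakly decreasing order. -/
def diagram {d : ℕ} (lam : d.Partition) : YoungDiagram :=
  YoungDiagram.ofRowLens (lam.parts.sort (· ≥ ·))
    (List.sortedGE_iff_pairwise.2 (Multiset.pairwise_sort _ _))

theorem card_diagram {d : ℕ} (lam : d.Partition) : (diagram lam).cells.card = d := by
  have key : ∀ w : List ℕ, (YoungDiagram.cellsOfRowLens w).card = w.sum := by
    intro w
    induction w with
    | nil => simp [YoungDiagram.cellsOfRowLens]
    | cons a w ih =>
      rw [YoungDiagram.cellsOfRowLens, Finset.card_union_of_disjoint, Finset.card_map, ih]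
      · simp
      · rw [Finset.disjoint_left]
        rintro ⟨i, j⟩ h1 h2
        simp at h1 h2
        grind
  change (YoungDiagram.cellsOfRowLens (lam.parts.sort (· ≥ ·))).card = d
  rw [key, ← Multiset.sum_coe, Multiset.sort_eq, lam.parts_sum]

/-- A Young tableau of shape `lam`: a filling of the cells by the elements of `Fin d`, each used
once. -/
abbrev Tableau {d : ℕ} (lam : d.Partition) : Type :=
  {c : ℕ × ℕ // c ∈ (diagram lam).cells} ≃ Fin d

/-- Some tableau of shape `lam` (all choices give isomorphic representations). -/
def someTableau {d : ℕ} (lam : d.Partition) : Tableau lam :=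
  Finset.equivFinOfCardEq (card_diagram lam)

/-- The row index of the cell of `T` that contains `x`. -/
def Tableau.row {d : ℕ} {lam : d.Partition} (T : Tableau lam) (x : Fin d) : ℕ :=
  (T.symm x).1.1

/-- The column index of the cell of `T` that contains `x`. -/
def Tableau.col {d : ℕ} {lam : d.Partition} (T : Tableau lam) (x : Fin d) : ℕ :=
  (T.symm x).1.2

/-- The group algebra `ℚ S_d`. -/
abbrev GroupAlg (d : ℕ) : Type := MonoidAlgebra ℚ (Equiv.Perm (Fin d))

/-- The row symmetrizer: the sum of all permutations that preserve every row of `T`. -/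
def rowSymmetrizer {d : ℕ} {lam : d.Partition} (T : Tableau lam) : GroupAlg d :=
  ∑ p : Equiv.Perm (Fin d) with ∀ x, Tableau.row T (p x) = Tableau.row T x,
    MonoidAlgebra.of ℚ (Equiv.Perm (Fin d)) p

/-- The column antisymmetrizer: the signed sum of all permutations that preserve every column
of `T`. -/
def colAntisymmetrizer {d : ℕ} {lam : d.Partition} (T : Tableau lam) : GroupAlg d :=
  ∑ q : Equiv.Perm (Fin d) with ∀ x, Tableau.col T (q x) = Tableau.col T x,
    ((Equiv.Perm.sign q : ℤ) : ℚ) • MonoidAlgebra.of ℚ (Equiv.Perm (Fin d)) q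

/-- The Young symmetrizer of a tableau. -/
def youngSymmetrizer {d : ℕ} {lam : d.Partition} (T : Tableau lam) : GroupAlg d :=
  rowSymmetrizer T * colAntisymmetrizer T

/-- The irreducible representation of `S_d` attached to `lam`: the left ideal of `ℚ S_d` generated
by a Young symmetrizer of shape `lam`. -/
abbrev SpechtModule {d : ℕ} (lam : d.Partition) : Ideal (GroupAlg d) :=
  Ideal.span {youngSymmetrizer (someTableau lam)}

/-- The irreducible character of `S_d` attached to `lam`: the trace of the action of a permutation
on the irreducible representation. -/
def irrChar {d : ℕ} (lam : d.Partition) (σ : Equiv.Perm (Fin d)) : ℚ :=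
  LinearMap.trace ℚ (SpechtModule lam)
    (Algebra.lsmul ℚ ℚ (SpechtModule lam) (MonoidAlgebra.of ℚ (Equiv.Perm (Fin d)) σ))

/-- For every partition `mu` of `d` there is a permutation of `Fin d` whose cycle lengths, fixed
points included, are the parts of `mu`. -/
theorem exists_perm {d : ℕ} (mu : d.Partition) :
    ∃ σ : Equiv.Perm (Fin d), σ.partition.parts = mu.parts := by
  have hsplit : mu.parts.filter (2 ≤ ·) + Multiset.replicate (mu.parts.count 1) 1 = mu.parts := by
    rw [← Multiset.filter_eq']
    conv_rhs => rw [← Multiset.filter_add_not (fun a => 2 ≤ a) mu.parts]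
    congr 1
    refine Multiset.filter_congr fun a ha => ?_
    have := mu.parts_pos ha
    omega
  have hsum := congrArg Multiset.sum hsplit
  rw [mu.parts_sum, Multiset.sum_add, Multiset.sum_replicate, smul_eq_mul, mul_one] at hsum
  obtain ⟨σ, hσ⟩ := (Equiv.Perm.exists_with_cycleType_iff (Fin d)
    (m := mu.parts.filter (2 ≤ ·))).2 ⟨by rw [Fintype.card_fin]; omega,
      fun a ha => (Multiset.mem_filter.1 ha).2⟩
  refine ⟨σ, ?_⟩
  rw [Equiv.Perm.parts_partition, ← Equiv.Perm.sum_cycleType, hσ, Fintype.card_fin]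
  conv_rhs => rw [← hsplit]
  congr 2
  omega

/-- `χ^lam_mu`: the value of the irreducible character attached to `lam` at a permutation of cycle
type `mu`. -/
def chi {d : ℕ} (lam mu : d.Partition) : ℚ :=
  irrChar lam (exists_perm mu).choose

/-- The shifted symmetric power sum
`p_k(lam) = ∑_{i ≥ 1} ((lam_i - i + 1/2)^k - (-i + 1/2)^k)`; here rows are numbered from `0`, and
the terms beyond the last row vanish. -/
def shiftedPowerSum {d : ℕ} (k : ℕ) (lam : d.Partition) : ℚ :=
  ∑ i ∈ Finset.range ((diagram lam).colLen 0),
    ((((diagram lam).rowLen i : ℚ) - ((i : ℚ) + 1) + 1 / 2) ^ k - (-((i : ℚ) + 1) + 1 / 2) ^ k)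

/-- The number `s` of completed `(r+1)`-cycles, determined by `r s = 2 g - 2 + l(al) + l(be)`
(meaningful when `r` divides the right-hand side). -/
def numCycles {d : ℕ} (g r : ℕ) (al be : d.Partition) : ℕ :=
  (2 * g + al.parts.card + be.parts.card - 2) / r

/-- The disconnected double Hurwitz number `H^{g,(r)}_{al,be}` with completed `(r+1)`-cycles. -/
def hurwitz {d : ℕ} (g r : ℕ) (al be : d.Partition) : ℚ :=
  1 / ((al.parts.prod : ℚ) * (be.parts.prod : ℚ)) *
    ∑ lam : d.Partition,
      chi lam al * (shiftedPowerSum (r + 1) lam / ((r + 1)! : ℚ)) ^ numCycles g r al be *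
        chi lam be

/-- The partition of `β_1 + ⋯ + β_n` with parts `β_1, …, β_n` (used for positive `β_i`). -/
def partitionOf {n : ℕ} (β : Fin n → ℕ) : (∑ i, β i).Partition :=
  Nat.Partition.ofSums _ (Finset.univ.val.map β) rfl

/-- The one-part double Hurwitz number with completed `3`-cycles `H^{g,(2)}_{(d),β}`, where
`d = β_1 + ⋯ + β_n`. -/
def onePartHurwitz (g : ℕ) {n : ℕ} (β : Fin n → ℕ) : ℚ :=
  hurwitz g 2 (Nat.Partition.indiscrete (∑ i, β i)) (partitionOf β)

/-- `P` is a polynomial expression of `d H^{g,(2)}_{(d),β} / s!`, `s = g + (n - 1) / 2`, in the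
parts `β_1, …, β_n` (`n` odd). -/
def IsHurwitzPolynomial (g : ℕ) {n : ℕ} (P : MvPolynomial (Fin n) ℚ) : Prop :=
  ∀ β : Fin n → ℕ, (∀ i, 0 < β i) →
    MvPolynomial.eval (fun i => (β i : ℚ)) P =
      ((∑ i, β i : ℕ) : ℚ) * onePartHurwitz g β / ((g + (n - 1) / 2)! : ℚ)

open Classical in
/-- The polynomial `d H^{g,(2)}_{(d),β} / s!` in `β_1, …, β_n`. -/
def hurwitzPolynomial (g n : ℕ) : MvPolynomial (Fin n) ℚ :=
  if h : ∃ P : MvPolynomial (Fin n) ℚ, IsHurwitzPolynomial g P then h.choose else 0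

/-- The combinatorial Hodge integral `⟨⟨τ_{b_1} ⋯ τ_{b_n} Λ_{2k}⟩⟩_g` for `n` odd; it vanishes
unless `b_1 + ⋯ + b_n + 2 k = 3 g + (n - 1) / 2`. -/
def combHodge (g k : ℕ) {n : ℕ} (b : Fin n → ℕ) : ℚ :=
  if ∑ i, b i + 2 * k = 3 * g + (n - 1) / 2 then
    (-1) ^ k * (hurwitzPolynomial g n).coeff (Finsupp.equivFunOnFinite.symm b)
  else 0

/-- The top degree term `⟨⟨τ_{b_1} ⋯ τ_{b_n}⟩⟩_g`. -/
def topTerm (g : ℕ) {n : ℕ} (b : Fin n → ℕ) : ℚ :=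
  combHodge g 0 b

end CompletedHurwitz

end

/-!
Multiplying by an element of a group algebra on the left and by another one on the right gives an
endomorphism whose trace, as a bilinear form, encodes the characters of all left ideals. The
induced characters of `Perm Zᶜ × Perm Z` split into two hook characters each, and this recursion in
the leg length `k` shows that the hook characters at cycle type `β` are, up to the sign `(-1) ^ k`,
the coefficients of `∏ (1 - X ^ β_i) / (1 - X)`. The alternating sum of the hook characters is
supported on long cycles, and the Specht modules of the other shapes are orthogonal to the hooks, so
their characters vanish on long cycles: only hooks contribute to one-part Hurwitz numbers.

The eigenvalue `p_3 / 3!` of the hook with leg length `k` is a quadratic function of the distance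
of `k` to the centre `(d - 1) / 2`, so the Hurwitz number is a combination of even moments of the
above coefficients about that centre. Their exponential generating function is
`∏ (2 sinh (β_i t / 2)) / (2 sinh (t / 2))`, which vanishes to order `n - 1` at `t = 0`; in genus
one only its terms of degree `n - 1` and `n + 1` are needed.
-/

noncomputable section

namespace CompletedHurwitz

section BiregularTrace

variable {k A : Type*}

section CommRing

variable [CommRing k] [Ring A] [Algebra k A]

variable (k) in
/-- The character of an algebra as a bimodule over itself: `biregularTrace k z x` is the trace of
the endomorphism `y ↦ z * y * x`. For an idempotent `x` it is the character of the left ideal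
generated by `x`, see `trace_lsmul_eq_biregularTrace`. -/
def biregularTrace : A →ₗ[k] A →ₗ[k] k :=
  ((LinearMap.mul k (Module.End k A)).compl₁₂ (LinearMap.mul k A)
    (LinearMap.mul k A).flip).compr₂ (LinearMap.trace k A)

lemma biregularTrace_apply (z x : A) : biregularTrace k z x =
    LinearMap.trace k A (LinearMap.mulLeft k z * LinearMap.mulRight k x) := rfl

lemma commute_mulLeft_mulRight (z x : A) :
    Commute (LinearMap.mulLeft k z) (LinearMap.mulRight k x) :=
  LinearMap.ext fun y => (mul_assoc z y x).symm

lemma biregularTrace_mul_comm_right (z x x' : A) :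
    biregularTrace k z (x * x') = biregularTrace k z (x' * x) := by
  rw [biregularTrace_apply, biregularTrace_apply, LinearMap.mulRight_mul, LinearMap.mulRight_mul,
    ← Module.End.mul_eq_comp, ← Module.End.mul_eq_comp, ← mul_assoc,
    LinearMap.trace_mul_comm, ← mul_assoc, ← (commute_mulLeft_mulRight z x).eq, mul_assoc]

lemma biregularTrace_mul_comm_left (z z' x : A) :
    biregularTrace k (z * z') x = biregularTrace k (z' * z) x := by
  rw [biregularTrace_apply, biregularTrace_apply, LinearMap.mulLeft_mul, LinearMap.mulLeft_mul,
    ← Module.End.mul_eq_comp, ← Module.End.mul_eq_comp, mul_assoc, LinearMap.trace_mul_comm,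
    mul_assoc, ← (commute_mulLeft_mulRight z x).eq, ← mul_assoc]

lemma biregularTrace_eq_zero {z x : A} (h : ∀ y, z * (y * x) = 0) : biregularTrace k z x = 0 := by
  rw [biregularTrace_apply, show LinearMap.mulLeft k z * LinearMap.mulRight k x = 0 from
    LinearMap.ext h, map_zero]

end CommRing

section Field

variable [Field k] [Ring A] [Algebra k A] [FiniteDimensional k A]

lemma trace_lsmul_eq_biregularTrace (I : Ideal A) {e : A} (he : e ∈ I) (hI : ∀ x ∈ I, x * e = x)
    (z : A) : LinearMap.trace k I (Algebra.lsmul k k I z) = biregularTrace k z e := by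
  let incl : I →ₗ[k] A := (Submodule.subtype I).restrictScalars k
  let proj : A →ₗ[k] I := (LinearMap.mulRight k e).codRestrict (I.restrictScalars k)
    fun x => I.mul_mem_left x he
  have hfactor : Algebra.lsmul k k I z = proj ∘ₗ (LinearMap.mulLeft k z ∘ₗ incl) := by
    ext x
    change z * (x : A) = z * (x : A) * e
    rw [mul_assoc, hI x x.2]
  rw [hfactor, LinearMap.trace_comp_comm', biregularTrace_apply]
  rfl

lemma trace_lsmul_span_singleton {x : A} {m : k} (hm : m ≠ 0) (hx : x * x = m • x) (z : A) :
    LinearMap.trace k (Ideal.span {x}) (Algebra.lsmul k k (Ideal.span {x}) z) =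
      m⁻¹ * biregularTrace k z x := by
  rw [← smul_eq_mul, ← map_smul]
  refine trace_lsmul_eq_biregularTrace _
    (Submodule.smul_of_tower_mem _ _ (Ideal.mem_span_singleton_self x)) (fun y hy => ?_) z
  obtain ⟨y, rfl⟩ := Ideal.mem_span_singleton'.1 hy
  rw [mul_assoc, mul_smul_comm, hx, inv_smul_smul₀ hm]

lemma exists_trace_lsmul_eq_biregularTrace [IsSemisimpleRing A] (I : Ideal A) :
    ∃ e ∈ I, ∀ z, LinearMap.trace k I (Algebra.lsmul k k I z) = biregularTrace k z e := by
  obtain ⟨e, he, rfl⟩ := IsSemisimpleRing.ideal_eq_span_idempotent I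
  refine ⟨e, Ideal.mem_span_singleton_self e,
    trace_lsmul_eq_biregularTrace _ (Ideal.mem_span_singleton_self e) fun x hx => ?_⟩
  obtain ⟨y, rfl⟩ := Ideal.mem_span_singleton'.1 hx
  rw [mul_assoc, he.eq]

end Field

section GroupAlgebra

open MonoidAlgebra

variable {G : Type*} [CommRing k] [Group G]

lemma biregularTrace_conj (z x : MonoidAlgebra k G) (h : G) :
    biregularTrace k z (of k G h * x * of k G h⁻¹) = biregularTrace k z x := by
  rw [biregularTrace_mul_comm_right, ← mul_assoc, ← map_mul, inv_mul_cancel, map_one, one_mul]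

lemma biregularTrace_of_conj (g h : G) (x : MonoidAlgebra k G) :
    biregularTrace k (of k G (h * g * h⁻¹)) x = biregularTrace k (of k G g) x := by
  rw [map_mul, biregularTrace_mul_comm_left, ← map_mul, ← mul_assoc, inv_mul_cancel, one_mul]

variable [Fintype G]

lemma monoidAlgebra_eq_sum (x : MonoidAlgebra k G) : x = ∑ g, x.coeff g • of k G g := by
  ext g
  simp

lemma biregularTrace_of (g : G) (x : MonoidAlgebra k G) :
    biregularTrace k (of k G g) x = ∑ h, x.coeff (h⁻¹ * g⁻¹ * h) := by
  classical
  rw [biregularTrace_apply, LinearMap.trace_eq_matrix_trace k (MonoidAlgebra.basis G k),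
    Matrix.trace]
  refine Finset.sum_congr rfl fun h _ => ?_
  rw [Matrix.diag_apply, LinearMap.toMatrix_apply]
  change (of k G g * (of k G h * x)).coeff h = _
  simp only [of_apply, coeff_single_mul_apply, one_mul, mul_assoc]

lemma sum_biregularTrace_of_mul_biregularTrace_of_inv (x y : MonoidAlgebra k G) :
    ∑ g, biregularTrace k (of k G g) x * biregularTrace k (of k G g⁻¹) y =
      Fintype.card G * biregularTrace k x y := by
  have hconj : ∀ h : G, ∑ g, x.coeff (h⁻¹ * g⁻¹ * h) * biregularTrace k (of k G g⁻¹) y =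
      biregularTrace k x y := by
    intro h
    conv_rhs => rw [monoidAlgebra_eq_sum x, map_sum, LinearMap.sum_apply]
    refine Fintype.sum_equiv ((Equiv.inv G).trans (MulAut.conj h⁻¹).toEquiv) _ _ fun g => ?_
    rw [map_smul, LinearMap.smul_apply, smul_eq_mul, ← biregularTrace_of_conj g⁻¹ h⁻¹ y]
    simp
  simp_rw [biregularTrace_of _ x, Finset.sum_mul]
  rw [Finset.sum_comm, Finset.sum_congr rfl fun h _ => hconj h, Finset.sum_const,
    Finset.card_univ, nsmul_eq_mul]

end GroupAlgebra

end BiregularTrace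

section TwistedSum

open MonoidAlgebra

variable {k G : Type*} [Group G] [Fintype G]

section CommRing

variable [CommRing k]

open Classical in
/-- The sum of the elements of a subgroup, weighted by a linear character. Symmetrizers and
antisymmetrizers of a group algebra are the cases of the trivial and the sign character. -/
def twistedSum (ε : G →* k) (H : Subgroup G) : MonoidAlgebra k G :=
  ∑ g with g ∈ H, ε g • of k G g

open Classical in
lemma coeff_twistedSum (ε : G →* k) (H : Subgroup G) (g : G) :
    (twistedSum ε H).coeff g = if g ∈ H then ε g else 0 := by
  simp [twistedSum, coeff_sum, Finsupp.single_apply]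

lemma of_mul_twistedSum (ε : G →* k) {H : Subgroup G} {h : G} (hh : h ∈ H) :
    of k G h * twistedSum ε H = ε h⁻¹ • twistedSum ε H := by
  classical
  ext g
  simp [coeff_twistedSum, mul_mem_cancel_left (inv_mem hh)]

lemma twistedSum_mul_of (ε : G →* k) {H : Subgroup G} {h : G} (hh : h ∈ H) :
    twistedSum ε H * of k G h = ε h⁻¹ • twistedSum ε H := by
  classical
  ext g
  simp [coeff_twistedSum, mul_mem_cancel_right (inv_mem hh), mul_comm]

lemma twistedSum_mul_twistedSum_of_le (ε : G →* k) {H K : Subgroup G} (hHK : H ≤ K) :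
    twistedSum ε H * twistedSum ε K = (Nat.card H : k) • twistedSum ε K := by
  classical
  rw [twistedSum, Finset.sum_mul, Finset.sum_congr rfl fun g hg => ?_, Finset.sum_const,
    ← Nat.cast_smul_eq_nsmul k, ← Fintype.card_subtype, Nat.card_eq_fintype_card]
  rw [smul_mul_assoc, of_mul_twistedSum ε (hHK (Finset.mem_filter.1 hg).2), smul_smul,
    ← map_mul, mul_inv_cancel, map_one, one_smul]

lemma twistedSum_map_conj (ε : G →* k) (H : Subgroup G) (g : G) :
    twistedSum ε (H.map (MulAut.conj g).toMonoidHom) =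
      of k G g * twistedSum ε H * of k G g⁻¹ := by
  classical
  ext h
  have hmem : h ∈ H.map (MulAut.conj g).toMonoidHom ↔ g⁻¹ * h * g ∈ H := by
    rw [Subgroup.mem_map_equiv]
    simp
  rw [coeff_twistedSum, if_congr hmem rfl rfl]
  have hε : ε (g⁻¹ * h * g) = ε h := by
    rw [map_mul, mul_comm, ← map_mul, mul_inv_cancel_left]
  simp [coeff_twistedSum, hε, ← mul_assoc]

lemma commute_twistedSum (ε δ : G →* k) {H K : Subgroup G} (h : ∀ g ∈ H, ∀ u ∈ K, Commute g u) :
    Commute (twistedSum ε H) (twistedSum δ K) := by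
  classical
  refine Commute.sum_left _ _ _ fun g hg => Commute.sum_right _ _ _ fun u hu => ?_
  refine ((Commute.map (h g ?_ u ?_) (of k G)).smul_left _).smul_right _
  exacts [(Finset.mem_filter.1 hg).2, (Finset.mem_filter.1 hu).2]

lemma twistedSum_eq_sum_cosets_mul (ε : G →* k) {H K : Subgroup G} {R : Finset G}
    (hHK : H ≤ K) (hR : ∀ r ∈ R, r ∈ K) (hcoset : ∀ g ∈ K, ∃! r, r ∈ R ∧ r⁻¹ * g ∈ H) :
    twistedSum ε K = (∑ r ∈ R, ε r • of k G r) * twistedSum ε H := by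
  classical
  ext g
  have hterm : ∀ r : G, (ε r • of k G r * twistedSum ε H).coeff g =
      if r⁻¹ * g ∈ H then ε g else 0 := fun r => by
    simp [coeff_twistedSum, ← map_mul]
  simp only [Finset.sum_mul, coeff_sum, Finsupp.finsetSum_apply, hterm, coeff_twistedSum]
  split_ifs with hg
  · obtain ⟨r, ⟨hrR, hr⟩, huniq⟩ := hcoset g hg
    rw [Finset.sum_eq_single_of_mem r hrR fun s hs hsr => if_neg fun h => hsr (huniq s ⟨hs, h⟩),
      if_pos hr]
  · refine (Finset.sum_eq_zero fun r hr => if_neg fun h => hg ?_).symm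
    simpa using K.mul_mem (hR r hr) (hHK h)

lemma coeff_twistedSum_mul_twistedSum (ε δ : G →* k) {H K : Subgroup G} (hHK : Disjoint H K)
    {g u : G} (hg : g ∈ H) (hu : u ∈ K) :
    (twistedSum ε H * twistedSum δ K).coeff (g * u) = ε g * δ u := by
  classical
  rw [twistedSum, Finset.sum_mul, coeff_sum, Finsupp.finsetSum_apply,
    Finset.sum_eq_single_of_mem g (by simpa using hg)]
  · simp [coeff_twistedSum, hu]
  · intro h hh hne
    have hne' : h⁻¹ * (g * u) ∉ K := fun hK => hne <| by
      rw [← mul_assoc, mul_mem_cancel_right hu] at hK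
      exact inv_mul_eq_one.1 (Subgroup.disjoint_def.1 hHK
        (mul_mem (inv_mem (Finset.mem_filter.1 hh).2) hg) hK)
    simp [coeff_twistedSum, hne']

lemma coeff_twistedSum_mul_twistedSum_of_notMem (ε δ : G →* k) {H K : Subgroup G} {g : G}
    (hg : ∀ h ∈ H, h⁻¹ * g ∉ K) : (twistedSum ε H * twistedSum δ K).coeff g = 0 := by
  classical
  rw [twistedSum, Finset.sum_mul, coeff_sum, Finsupp.finsetSum_apply]
  refine Finset.sum_eq_zero fun h hh => ?_
  simp [coeff_twistedSum, hg h (Finset.mem_filter.1 hh).2]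

end CommRing

section Field

variable [Field k]

lemma twistedSum_mul_of_mul_twistedSum_eq_zero {ε δ : G →* k} {H K : Subgroup G} {g u : G}
    (hu : u ∈ K) (hgu : g * u * g⁻¹ ∈ H) (hne : ε u ≠ δ u) :
    twistedSum ε H * (of k G g * twistedSum δ K) = 0 := by
  have hε : ε (g * u * g⁻¹) = ε u := by
    rw [map_mul, mul_comm, ← map_mul, inv_mul_cancel_left]
  have hmove : ε u • (twistedSum ε H * (of k G g * twistedSum δ K)) =
      δ u • (twistedSum ε H * (of k G g * twistedSum δ K)) := by
    have hleft := twistedSum_mul_of ε (inv_mem hgu)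
    have hright := of_mul_twistedSum δ (inv_mem hu)
    rw [inv_inv] at hleft hright
    rw [← hε, ← smul_mul_assoc, ← hleft, ← mul_smul_comm, ← mul_smul_comm, ← hright, mul_assoc,
      ← mul_assoc (of k G _), ← map_mul, ← mul_assoc (of k G g), ← map_mul, conj_inv,
      inv_mul_cancel_right]
  have hsub : (ε u - δ u) • (twistedSum ε H * (of k G g * twistedSum δ K)) = 0 := by
    rw [sub_smul, hmove, sub_self]
  exact (smul_eq_zero.1 hsub).resolve_left (sub_ne_zero.2 hne)

lemma twistedSum_mul_mul_twistedSum_eq_zero {ε δ : G →* k} {H K : Subgroup G}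
    (h : ∀ g, ∃ u ∈ K, g * u * g⁻¹ ∈ H ∧ ε u ≠ δ u) (z : MonoidAlgebra k G) :
    twistedSum ε H * (z * twistedSum δ K) = 0 := by
  rw [monoidAlgebra_eq_sum z, Finset.sum_mul, Finset.mul_sum]
  refine Finset.sum_eq_zero fun g _ => ?_
  obtain ⟨u, hu, hgu, hne⟩ := h g
  rw [smul_mul_assoc, mul_smul_comm, twistedSum_mul_of_mul_twistedSum_eq_zero hu hgu hne,
    smul_zero]

end Field

end TwistedSum

section PermSubgroups

open MonoidAlgebra Equiv

variable {k α : Type*}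

/-- The subgroup of the permutations that fix every point outside `X`, that is, the copy of the
symmetric group on `X` inside `Perm α`. -/
def permsOn (X : Finset α) : Subgroup (Perm α) :=
  fixingSubgroup (Perm α) (X : Set α)ᶜ

/-- The subgroup of the permutations that preserve every fiber of `f`. -/
def fiberPerms {β : Type*} (f : α → β) : Subgroup (Perm α) where
  carrier := {p | ∀ x, f (p x) = f x}
  one_mem' _ := rfl
  mul_mem' hp hq x := (hp _).trans (hq x)
  inv_mem' {p} hp x := by simpa using (hp (p⁻¹ x)).symm

lemma mem_permsOn {X : Finset α} {p : Perm α} : p ∈ permsOn X ↔ ∀ x ∉ X, p x = x :=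
  mem_fixingSubgroup_iff _

lemma mem_fiberPerms {β : Type*} {f : α → β} {p : Perm α} :
    p ∈ fiberPerms f ↔ ∀ x, f (p x) = f x := Iff.rfl

lemma permsOn_mono {X Y : Finset α} (h : X ⊆ Y) : permsOn X ≤ permsOn Y := fun _ hp =>
  mem_permsOn.2 fun x hx => mem_permsOn.1 hp x fun hX => hx (h hX)

lemma exists_perm_map_eq [Finite α] {Z W : Finset α} (h : Z.card = W.card) {o p : α}
    (ho : o ∉ Z) (hp : p ∉ W) : ∃ g : Perm α, Z.map g.toEmbedding = W ∧ g o = p := by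
  classical
  have := Fintype.ofFinite α
  set e : Perm α := (Finset.equivOfCardEq h).extendSubtype
  have heZ : ∀ x ∈ Z, e x ∈ W := fun x hx => extendSubtype_mem _ x hx
  have heo : e o ∉ W := extendSubtype_not_mem _ o ho
  refine ⟨swap (e o) p * e, Finset.eq_of_subset_of_card_le ?_ (by rw [Finset.card_map, h]), ?_⟩
  · refine Finset.map_subset_iff_subset_preimage.2 fun x hx => ?_
    have := heZ x hx
    simpa [swap_apply_of_ne_of_ne (ne_of_mem_of_not_mem this heo) (ne_of_mem_of_not_mem this hp)]
  · simp

lemma apply_mem_iff_of_mem_permsOn {X : Finset α} {p : Perm α} (hp : p ∈ permsOn X) {x : α} :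
    p x ∈ X ↔ x ∈ X := by
  refine not_iff_not.1 ⟨fun h => ?_, fun h => by rwa [mem_permsOn.1 hp x h]⟩
  rwa [p.injective (mem_permsOn.1 hp _ h)] at h

lemma disjoint_of_mem_permsOn {X Y : Finset α} (h : Disjoint X Y) {p q : Perm α}
    (hp : p ∈ permsOn X) (hq : q ∈ permsOn Y) : p.Disjoint q := fun x => by
  by_cases hx : x ∈ X
  · exact Or.inr (mem_permsOn.1 hq x (Finset.disjoint_left.1 h hx))
  · exact Or.inl (mem_permsOn.1 hp x hx)

lemma disjoint_permsOn {X Y : Finset α} (h : Disjoint X Y) : Disjoint (permsOn X) (permsOn Y) :=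
  Subgroup.disjoint_def.2 fun hp hq =>
    Perm.disjoint_refl_iff.1 (disjoint_of_mem_permsOn h hp hq)

lemma map_conj_permsOn (X : Finset α) (g : Perm α) :
    (permsOn X).map (MulAut.conj g).toMonoidHom = permsOn (X.map g.toEmbedding) := by
  ext p
  rw [Subgroup.mem_map_equiv, mem_permsOn, mem_permsOn, ← g⁻¹.forall_congr_right]
  simp [← Perm.inv_def]

lemma natCard_permsOn (X : Finset α) : Nat.card (permsOn X) = X.card ! := by
  classical
  rw [← Fintype.card_coe, ← Fintype.card_perm, ← Nat.card_eq_fintype_card]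
  exact Nat.card_congr ((Equiv.subtypeEquivRight fun p => mem_permsOn).trans
    (Perm.subtypeEquivSubtypePerm (· ∈ X)).symm)

section DecidableEq

variable [DecidableEq α]

lemma swap_mem_permsOn {X : Finset α} {x y : α} (hx : x ∈ X) (hy : y ∈ X) :
    swap x y ∈ permsOn X :=
  mem_permsOn.2 fun _ hz =>
    swap_apply_of_ne_of_ne (fun h => hz (h ▸ hx)) fun h => hz (h ▸ hy)

lemma swap_mem_fiberPerms {β : Type*} {f : α → β} {x y : α} (h : f x = f y) :
    swap x y ∈ fiberPerms f := fun z => by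
  rw [swap_apply_def]
  split_ifs with hx hy
  exacts [hx ▸ h.symm, hy ▸ h, rfl]

end DecidableEq

variable [Fintype α]

/-- Rows and columns of a hook are of this kind: all fibers but one are singletons. -/
lemma fiberPerms_eq_permsOn {β : Type*} [DecidableEq β] {f : α → β} {b : β}
    (hf : {x | f x ≠ b}.InjOn f) : fiberPerms f = permsOn {x | f x = b} := by
  ext p
  rw [mem_fiberPerms, mem_permsOn]
  refine ⟨fun hp x hx => ?_, fun hp x => ?_⟩
  · have hx' : f x ≠ b := by simpa using hx
    exact hf (by rwa [Set.mem_ofPred_eq, hp]) hx' (hp x)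
  · by_cases hx : f x = b
    · have := (apply_mem_iff_of_mem_permsOn (mem_permsOn.2 hp)).2
        (Finset.mem_filter.2 ⟨Finset.mem_univ x, hx⟩)
      rw [(Finset.mem_filter.1 this).2, hx]
    · rw [hp x (by simpa using hx)]

variable [DecidableEq α]

variable (k α) in
/-- The sign of a permutation, as a linear character with values in `k`. -/
def signChar [CommRing k] : Perm α →* k :=
  (Int.castRingHom k : ℤ →* k).comp ((Units.coeHom ℤ).comp Perm.sign)

lemma signChar_apply [CommRing k] (p : Perm α) : signChar k α p = ((Perm.sign p : ℤ) : k) := rfl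

lemma signChar_swap [CommRing k] {x y : α} (h : x ≠ y) : signChar k α (swap x y) = -1 := by
  simp [signChar_apply, Perm.sign_swap h]

section CommRing

variable [CommRing k]

lemma twistedSum_permsOn_insert (ε : Perm α →* k) {X : Finset α} {y : α} (hy : y ∉ X) :
    twistedSum ε (permsOn (insert y X)) =
      (1 + ∑ x ∈ X, ε (swap x y) • of k (Perm α) (swap x y)) * twistedSum ε (permsOn X) := by
  have hinj : Function.Injective fun x => swap x y := fun x x' h => by
    simpa using Equiv.congr_fun h y
  have hcoset : ∀ g ∈ permsOn (insert y X),
      ∃! r, r ∈ (insert y X).image (swap · y) ∧ r⁻¹ * g ∈ permsOn X := by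
    intro g hg
    refine ⟨swap (g y) y, ⟨Finset.mem_image_of_mem _ ?_, mem_permsOn.2 fun z hz => ?_⟩, ?_⟩
    · exact (apply_mem_iff_of_mem_permsOn hg).2 (Finset.mem_insert_self y X)
    · by_cases hzy : z = y
      · simp [hzy]
      · have hgz : g z = z := mem_permsOn.1 hg z (by simp [hz, hzy])
        have hzg : z ≠ g y := fun h => hzy (g.injective (hgz.trans h))
        simp [hgz, swap_apply_of_ne_of_ne hzg hzy]
    · rintro r ⟨hr, hrg⟩
      obtain ⟨x, -, rfl⟩ := Finset.mem_image.1 hr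
      have hxy : swap x y (g y) = y := by simpa using mem_permsOn.1 hrg y hy
      rw [swap_apply_eq_iff, swap_apply_right] at hxy
      rw [hxy]
  have hR : ∀ r ∈ (insert y X).image (swap · y), r ∈ permsOn (insert y X) :=
    Finset.forall_mem_image.2 fun x hx => swap_mem_permsOn hx (Finset.mem_insert_self y X)
  rw [twistedSum_eq_sum_cosets_mul ε (permsOn_mono (Finset.subset_insert y X)) hR hcoset,
    Finset.sum_image hinj.injOn, Finset.sum_insert hy]
  simp only [swap_self, ← Perm.one_def, map_one, one_smul]

lemma twistedSum_mul_swap_mul_twistedSum {X : Finset α} {o x y : α} (ho : o ∈ X) (hx : x ∈ X)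
    (hy : y ∉ X) :
    twistedSum (1 : Perm α →* k) (permsOn X) * of k _ (swap x y) * twistedSum 1 (permsOn X) =
      twistedSum 1 (permsOn X) * of k _ (swap o y) * twistedSum 1 (permsOn X) := by
  obtain rfl | - := eq_or_ne x o
  · rfl
  have hconj : swap x y = swap o x * swap o y * swap o x := by
    rw [swap_comm o y]
    exact (swap_mul_swap_mul_swap (ne_of_mem_of_not_mem ho hy).symm
      (ne_of_mem_of_not_mem hx hy).symm).symm
  have habsorb : swap o x ∈ permsOn X := swap_mem_permsOn ho hx
  calc _ = (twistedSum 1 (permsOn X) * of k _ (swap o x)) * of k _ (swap o y) *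
        (of k _ (swap o x) * twistedSum 1 (permsOn X)) := by
        simp only [hconj, map_mul, mul_assoc]
    _ = _ := by
        simp only [twistedSum_mul_of _ habsorb, of_mul_twistedSum _ habsorb, MonoidHom.one_apply,
          one_smul]

end CommRing

section Field

variable [Field k]

lemma twistedSum_mul_swap_mul_twistedSum_eq_smul_sub [CharZero k] {X : Finset α} {o y : α}
    (ho : o ∈ X) (hy : y ∉ X) :
    twistedSum (1 : Perm α →* k) (permsOn X) * of k _ (swap o y) * twistedSum 1 (permsOn X) =
      ((X.card - 1)! : k) •
        (twistedSum 1 (permsOn (insert y X)) - twistedSum 1 (permsOn X)) := by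
  have hX : X.card ≠ 0 := Finset.card_ne_zero_of_mem ho
  have hexpand : (X.card ! : k) • twistedSum 1 (permsOn (insert y X)) =
      (X.card ! : k) • twistedSum 1 (permsOn X) + (X.card : k) •
        (twistedSum 1 (permsOn X) * of k _ (swap o y) * twistedSum 1 (permsOn X)) := by
    rw [← natCard_permsOn X,
      ← twistedSum_mul_twistedSum_of_le 1 (permsOn_mono (Finset.subset_insert y X)),
      ← twistedSum_mul_twistedSum_of_le 1 le_rfl, twistedSum_permsOn_insert 1 hy, add_mul, one_mul,
      mul_add, Finset.sum_mul, Finset.mul_sum, Nat.cast_smul_eq_nsmul, ← Finset.sum_const]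
    congr 1
    refine Finset.sum_congr rfl fun x hx => ?_
    rw [← twistedSum_mul_swap_mul_twistedSum ho hx hy, MonoidHom.one_apply, one_smul, mul_assoc]
  rw [← Nat.mul_factorial_pred hX, Nat.cast_mul, mul_smul, mul_smul, ← smul_add] at hexpand
  rw [smul_sub, smul_right_injective _ (Nat.cast_ne_zero.2 hX : (X.card : k) ≠ 0) hexpand,
    add_sub_cancel_left]

/-- The pigeonhole principle behind the orthogonality of Specht modules: every translate of a set
with more than `n` elements has two points in a common fiber. -/
lemma twistedSum_fiberPerms_mul_mul_twistedSum_permsOn {ε δ : Perm α →* k}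
    (hεδ : ∀ x y, x ≠ y → ε (swap x y) ≠ δ (swap x y)) {f : α → ℕ} {n : ℕ} (hf : ∀ x, f x < n)
    {Y : Finset α} (hY : n < Y.card) (z : MonoidAlgebra k (Perm α)) :
    twistedSum ε (fiberPerms f) * (z * twistedSum δ (permsOn Y)) = 0 := by
  refine twistedSum_mul_mul_twistedSum_eq_zero (fun g => ?_) z
  obtain ⟨u, hu, v, hv, huv, hfuv⟩ := Finset.exists_ne_map_eq_of_card_lt_of_maps_to
    (s := Y) (t := Finset.range n) (by simpa using hY)
    (f := fun x => f (g x)) (fun x _ => by simpa using hf (g x))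
  refine ⟨swap u v, swap_mem_permsOn hu hv, ?_, hεδ u v huv⟩
  rw [mul_swap_eq_swap_mul, mul_inv_cancel_right]
  exact swap_mem_fiberPerms hfuv

end Field

end PermSubgroups

section HookElement

open MonoidAlgebra Equiv

variable {α : Type*} [Fintype α] [DecidableEq α]

/-- The Young symmetrizer of a tableau of hook shape with corner `o`, remaining column entries `Z`
and remaining row entries `(insert o Z)ᶜ` (meaningful for `o ∉ Z`). -/
def hookElement (Z : Finset α) (o : α) : MonoidAlgebra ℚ (Perm α) :=
  twistedSum 1 (permsOn Zᶜ) * twistedSum (signChar ℚ α) (permsOn (insert o Z))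

lemma commute_twistedSum_permsOn_compl (ε δ : Perm α →* ℚ) (Z : Finset α) :
    Commute (twistedSum ε (permsOn Zᶜ)) (twistedSum δ (permsOn Z)) :=
  commute_twistedSum ε δ fun _ hp _ hq =>
    (disjoint_of_mem_permsOn disjoint_compl_left hp hq).commute

lemma twistedSum_signChar_permsOn_insert {Z : Finset α} {o : α} (ho : o ∉ Z) :
    twistedSum (signChar ℚ α) (permsOn (insert o Z)) =
      (1 - ∑ y ∈ Z, of ℚ _ (swap o y)) * twistedSum (signChar ℚ α) (permsOn Z) := by
  rw [twistedSum_permsOn_insert _ ho, sub_eq_add_neg, ← Finset.sum_neg_distrib]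
  congr 2
  refine Finset.sum_congr rfl fun y hy => ?_
  rw [signChar_swap (ne_of_mem_of_not_mem hy ho), neg_one_smul, swap_comm]

lemma twistedSum_permsOn_mul_twistedSum_permsOn_eq_zero {X Y : Finset α} {x y : α} (hxy : x ≠ y)
    (hX : x ∈ X ∧ y ∈ X) (hY : x ∈ Y ∧ y ∈ Y) :
    twistedSum 1 (permsOn X) * twistedSum (signChar ℚ α) (permsOn Y) = 0 := by
  have h := twistedSum_mul_of_mul_twistedSum_eq_zero (ε := 1) (δ := signChar ℚ α) (g := 1)
    (H := permsOn X) (swap_mem_permsOn hY.1 hY.2) (by simpa using swap_mem_permsOn hX.1 hX.2)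
    (by rw [signChar_swap hxy, MonoidHom.one_apply]; norm_num)
  rwa [map_one, one_mul] at h

lemma twistedSum_mul_swap_mul_hookElement {Z : Finset α} {o y : α} (ho : o ∉ Z) (hy : y ∈ Z) :
    twistedSum 1 (permsOn Zᶜ) * of ℚ _ (swap o y) * hookElement Z o =
      -((Zᶜ.card - 1)! : ℚ) • hookElement Z o := by
  have hoZ : o ∈ Zᶜ := Finset.mem_compl.2 ho
  rw [hookElement, ← mul_assoc, twistedSum_mul_swap_mul_twistedSum_eq_smul_sub hoZ (by simpa),
    smul_mul_assoc, sub_mul, twistedSum_permsOn_mul_twistedSum_permsOn_eq_zero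
      (ne_of_mem_of_not_mem hy ho) ⟨Finset.mem_insert_self _ _, Finset.mem_insert_of_mem hoZ⟩
      ⟨Finset.mem_insert_of_mem hy, Finset.mem_insert_self _ _⟩, zero_sub, smul_neg, neg_smul]

lemma hookElement_mul_self {Z : Finset α} {o : α} (ho : o ∉ Z) :
    hookElement Z o * hookElement Z o =
      ((Fintype.card α : ℚ) * (Zᶜ.card - 1)! * Z.card !) • hookElement Z o := by
  set a := twistedSum (1 : Perm α →* ℚ) (permsOn Zᶜ)
  set b := twistedSum (signChar ℚ α) (permsOn Z) with hb
  set b' := twistedSum (signChar ℚ α) (permsOn (insert o Z)) with hb'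
  have haa : a * a = (Zᶜ.card ! : ℚ) • a := by
    rw [twistedSum_mul_twistedSum_of_le 1 le_rfl, natCard_permsOn]
  have hbb : b * b' = (Z.card ! : ℚ) • b' := by
    rw [twistedSum_mul_twistedSum_of_le _ (permsOn_mono (Finset.subset_insert o Z)),
      natCard_permsOn]
  have hcomm : b * a = a * b := (commute_twistedSum_permsOn_compl 1 (signChar ℚ α) Z).eq.symm
  have hcard : (Fintype.card α : ℚ) = Zᶜ.card + Z.card := mod_cast (Z.card_compl_add_card).symm
  have hfact : (Zᶜ.card ! : ℚ) = Zᶜ.card * (Zᶜ.card - 1)! := mod_cast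
    (Nat.mul_factorial_pred (Finset.card_ne_zero_of_mem (Finset.mem_compl.2 ho))).symm
  calc a * b' * (a * b')
      = a * (1 - ∑ y ∈ Z, of ℚ _ (swap o y)) * (b * a) * b' := by
        simp only [hb', twistedSum_signChar_permsOn_insert ho, ← hb, mul_assoc]
    _ = a * (1 - ∑ y ∈ Z, of ℚ _ (swap o y)) * a * (b * b') := by
        rw [hcomm]; simp only [mul_assoc]
    _ = (Z.card ! : ℚ) • ((a * a) * b' - ∑ y ∈ Z, a * of ℚ _ (swap o y) * (a * b')) := by
        rw [hbb, mul_smul_comm, mul_sub, mul_one, sub_mul, sub_mul, Finset.mul_sum,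
          Finset.sum_mul, Finset.sum_mul]
        simp only [mul_assoc]
    _ = (Z.card ! : ℚ) • ((Zᶜ.card ! : ℚ) • (a * b') -
          ∑ _ ∈ Z, -((Zᶜ.card - 1)! : ℚ) • (a * b')) := by
        rw [haa, smul_mul_assoc]
        congr 2
        exact Finset.sum_congr rfl fun y hy => twistedSum_mul_swap_mul_hookElement ho hy
    _ = _ := by
        rw [Finset.sum_const, ← Nat.cast_smul_eq_nsmul ℚ, smul_smul, ← sub_smul, smul_smul, hcard,
          hfact]
        congr 1
        ring

lemma biregularTrace_hookElement (z : MonoidAlgebra ℚ (Perm α)) {Z : Finset α} {o : α}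
    (ho : o ∉ Z) :
    biregularTrace ℚ z (hookElement Z o) =
      biregularTrace ℚ z (twistedSum 1 (permsOn Zᶜ) * twistedSum (signChar ℚ α) (permsOn Z)) -
        ∑ y ∈ Z, biregularTrace ℚ z (twistedSum 1 (permsOn Zᶜ) *
          twistedSum (signChar ℚ α) (permsOn Z) * of ℚ _ (swap o y)) := by
  have hcomm := (commute_twistedSum_permsOn_compl 1 (signChar ℚ α) Z).eq
  rw [hookElement, twistedSum_signChar_permsOn_insert ho, sub_mul, one_mul, mul_sub, map_sub,
    Finset.sum_mul, Finset.mul_sum, map_sum]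
  congr 1
  refine Finset.sum_congr rfl fun y _ => ?_
  rw [← mul_assoc, biregularTrace_mul_comm_right, ← mul_assoc, hcomm]

lemma biregularTrace_hookElement_erase (z : MonoidAlgebra ℚ (Perm α)) {Z : Finset α} {y : α}
    (hy : y ∈ Z) :
    biregularTrace ℚ z (hookElement (Z.erase y) y) =
      biregularTrace ℚ z (twistedSum 1 (permsOn Zᶜ) * twistedSum (signChar ℚ α) (permsOn Z)) +
        ∑ o ∈ Zᶜ, biregularTrace ℚ z (twistedSum 1 (permsOn Zᶜ) *
          twistedSum (signChar ℚ α) (permsOn Z) * of ℚ _ (swap o y)) := by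
  rw [hookElement, Finset.compl_erase, Finset.insert_erase hy,
    twistedSum_permsOn_insert 1 (by simpa), add_mul, one_mul, add_mul, map_add,
    Finset.sum_mul, Finset.sum_mul, map_sum]
  refine congrArg _ (Finset.sum_congr rfl fun o _ => ?_)
  rw [MonoidHom.one_apply, one_smul, mul_assoc, biregularTrace_mul_comm_right]

/-- This recursion in the leg length computes the hook characters: it is the branching of the
character induced from the trivial times sign character of `permsOn Zᶜ × permsOn Z`. -/
lemma sum_biregularTrace_hookElement (z : MonoidAlgebra ℚ (Perm α)) (Z : Finset α) :
    ∑ o ∈ Zᶜ, biregularTrace ℚ z (hookElement Z o) +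
        ∑ y ∈ Z, biregularTrace ℚ z (hookElement (Z.erase y) y) =
      Fintype.card α *
        biregularTrace ℚ z (twistedSum 1 (permsOn Zᶜ) *
          twistedSum (signChar ℚ α) (permsOn Z)) := by
  have hcard : (Fintype.card α : ℚ) = Zᶜ.card + Z.card := mod_cast (Z.card_compl_add_card).symm
  rw [Finset.sum_congr rfl fun o ho => biregularTrace_hookElement z (Finset.mem_compl.1 ho),
    Finset.sum_congr rfl fun y hy => biregularTrace_hookElement_erase z hy,
    Finset.sum_sub_distrib, Finset.sum_add_distrib, Finset.sum_comm (s := Z) (t := Zᶜ)]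
  simp only [Finset.sum_const, nsmul_eq_mul]
  rw [hcard]
  ring

lemma hookElement_map (g : Perm α) (Z : Finset α) (o : α) :
    hookElement (Z.map g.toEmbedding) (g o) = of ℚ _ g * hookElement Z o * of ℚ _ g⁻¹ := by
  have hinsert : insert (g o) (Z.map g.toEmbedding) = (insert o Z).map g.toEmbedding :=
    (Finset.map_insert ..).symm
  have hcompl : (Z.map g.toEmbedding)ᶜ = Zᶜ.map g.toEmbedding := by
    ext x; simp [Finset.mem_map_equiv]
  rw [hookElement, hinsert, hcompl, ← map_conj_permsOn, ← map_conj_permsOn, twistedSum_map_conj,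
    twistedSum_map_conj, hookElement]
  simp only [mul_assoc]
  rw [← mul_assoc (of ℚ _ g⁻¹) (of ℚ _ g), ← map_mul, inv_mul_cancel, map_one, one_mul]

lemma biregularTrace_hookElement_congr (z : MonoidAlgebra ℚ (Perm α)) {Z W : Finset α}
    (h : Z.card = W.card) {o p : α} (ho : o ∉ Z) (hp : p ∉ W) :
    biregularTrace ℚ z (hookElement Z o) = biregularTrace ℚ z (hookElement W p) := by
  obtain ⟨g, rfl, rfl⟩ := exists_perm_map_eq h ho hp
  rw [hookElement_map, biregularTrace_conj]

end HookElement

section Cycles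

open MonoidAlgebra Equiv

variable {α : Type*} [Fintype α] [DecidableEq α]

/-- The set of cycles of a permutation, fixed points included. Mathlib's `cycleFactorsFinset` only
contains the nontrivial ones. -/
abbrev CycleIndex (π : Perm α) : Type _ := π.cycleFactorsFinset ⊕ {x // π x = x}

/-- The set of points of a cycle. -/
def cyclePoints {π : Perm α} : CycleIndex π → Finset α :=
  Sum.elim (fun c => c.1.support) fun x => {x.1}

/-- The cycle of `π` through `x`. -/
def cycleIndex (π : Perm α) (x : α) : CycleIndex π :=
  if h : π x = x then Sum.inr ⟨x, h⟩
  else Sum.inl ⟨π.cycleOf x, Perm.cycleOf_mem_cycleFactorsFinset_iff.2 (Perm.mem_support.2 h)⟩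

variable {π : Perm α}

lemma cycleIndex_eq_iff {x : α} {c : CycleIndex π} : cycleIndex π x = c ↔ x ∈ cyclePoints c := by
  rw [cycleIndex]
  obtain c | y := c
  · split_ifs with hx
    · simpa [cyclePoints] using fun h : x ∈ c.1.support =>
        Perm.mem_support.1 (Perm.mem_cycleFactorsFinset_support_le c.2 h) hx
    · rw [Sum.inl.injEq, Subtype.ext_iff]
      refine ⟨fun h => ?_, fun h => (Perm.cycle_is_cycleOf h c.2).symm⟩
      change x ∈ c.1.support
      exact h ▸ Perm.mem_support_cycleOf_iff.2 ⟨Perm.SameCycle.refl _ _, Perm.mem_support.2 hx⟩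
  · split_ifs with hx
    · simp [cyclePoints, Subtype.ext_iff]
    · simpa [cyclePoints] using fun h : x = y.1 => hx (h ▸ y.2)

lemma cyclePoints_nonempty (c : CycleIndex π) : (cyclePoints c).Nonempty := by
  obtain c | y := c
  · exact (Perm.mem_cycleFactorsFinset_iff.1 c.2).1.nonempty_support
  · exact Finset.singleton_nonempty y.1

lemma cycleIndex_surjective (π : Perm α) : Function.Surjective (cycleIndex π) := fun c =>
  (cyclePoints_nonempty c).imp fun _ => cycleIndex_eq_iff.2

lemma cycleIndex_eq_cycleIndex_iff {x y : α} :
    cycleIndex π x = cycleIndex π y ↔ π.SameCycle x y := by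
  rw [cycleIndex_eq_iff, cycleIndex]
  split_ifs with hy
  · refine Finset.mem_singleton.trans ⟨fun h => h ▸ Perm.SameCycle.refl _ _, fun h => ?_⟩
    exact h.eq_of_right hy
  · exact (Perm.mem_support_cycleOf_iff' hy).trans Perm.sameCycle_comm

@[simp]
lemma cycleIndex_apply (π : Perm α) (x : α) : cycleIndex π (π x) = cycleIndex π x :=
  cycleIndex_eq_cycleIndex_iff.2 (Perm.sameCycle_apply_left.2 (Perm.SameCycle.refl _ _))

lemma prod_card_cyclePoints {M : Type*} [CommMonoid M] (π : Perm α) (F : ℕ → M) :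
    ∏ c : CycleIndex π, F (cyclePoints c).card = (π.partition.parts.map F).prod := by
  rw [Fintype.prod_sum_type, Perm.parts_partition, Multiset.map_add, Multiset.prod_add,
    Multiset.map_replicate, Multiset.prod_replicate, Perm.cycleType_def, Multiset.map_map]
  congr 1
  · exact Finset.prod_coe_sort π.cycleFactorsFinset fun c => F c.support.card
  · have hfixed : Fintype.card {x // π x = x} = Fintype.card α - π.support.card := by
      rw [← Finset.card_compl, Fintype.card_subtype]
      congr 1
      ext x
      simp
    simp [cyclePoints, hfixed]

/-- The union of a set of cycles. -/
def cycleUnion (S : Finset (CycleIndex π)) : Finset α := S.biUnion cyclePoints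

lemma mem_cycleUnion {S : Finset (CycleIndex π)} {x : α} :
    x ∈ cycleUnion S ↔ cycleIndex π x ∈ S := by
  simp [cycleUnion, ← cycleIndex_eq_iff]

lemma card_cycleUnion (S : Finset (CycleIndex π)) :
    (cycleUnion S).card = ∑ c ∈ S, (cyclePoints c).card :=
  Finset.card_biUnion fun _ _ _ _ hcc' => Finset.disjoint_left.2 fun _ hx hx' =>
    hcc' ((cycleIndex_eq_iff.2 hx).symm.trans (cycleIndex_eq_iff.2 hx'))

lemma cycleUnion_injective (π : Perm α) :
    Function.Injective (cycleUnion : Finset (CycleIndex π) → Finset α) := fun S T h => by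
  ext c
  obtain ⟨x, rfl⟩ := cycleIndex_surjective π c
  rw [← mem_cycleUnion, h, mem_cycleUnion]

lemma cycleUnion_compl (S : Finset (CycleIndex π)) : cycleUnion Sᶜ = (cycleUnion S)ᶜ := by
  ext x
  simp [mem_cycleUnion]

lemma exists_cycleUnion_eq {Z : Finset α} (h : ∀ x, π x ∈ Z ↔ x ∈ Z) :
    ∃ S : Finset (CycleIndex π), cycleUnion S = Z := by
  refine ⟨Z.image (cycleIndex π), Finset.ext fun x => ?_⟩
  rw [mem_cycleUnion, Finset.mem_image]
  refine ⟨?_, fun hx => ⟨x, hx, rfl⟩⟩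
  rintro ⟨y, hy, hyx⟩
  obtain ⟨i, -, rfl⟩ := (cycleIndex_eq_cycleIndex_iff.1 hyx).exists_pow_eq'
  clear hyx
  induction i with
  | zero => exact hy
  | succ i ih => rwa [pow_succ', Perm.mul_apply, h]

/-- The permutation that agrees with `π` on the cycles in `S` and is the identity elsewhere. -/
def onCycles (S : Finset (CycleIndex π)) : Perm α :=
  Perm.ofSubtype (π.subtypePerm (p := fun x => cycleIndex π x ∈ S) fun x => by simp)

lemma onCycles_apply (S : Finset (CycleIndex π)) (x : α) :
    onCycles S x = if cycleIndex π x ∈ S then π x else x := by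
  rw [onCycles]
  split_ifs with h
  · exact Perm.ofSubtype_apply_of_mem (p := fun x => cycleIndex π x ∈ S) _ h
  · exact Perm.ofSubtype_apply_of_not_mem (p := fun x => cycleIndex π x ∈ S) _ h

lemma onCycles_mem_permsOn (S : Finset (CycleIndex π)) : onCycles S ∈ permsOn (cycleUnion S) :=
  mem_permsOn.2 fun x hx => by rw [onCycles_apply, if_neg (by rwa [← mem_cycleUnion])]

lemma onCycles_union {S T : Finset (CycleIndex π)} (h : Disjoint S T) :
    onCycles (S ∪ T) = onCycles S * onCycles T := by
  ext x
  simp only [Perm.mul_apply, onCycles_apply, Finset.mem_union, apply_ite (cycleIndex π),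
    cycleIndex_apply, ite_self]
  by_cases hS : cycleIndex π x ∈ S
  · simp [hS, Finset.disjoint_left.1 h hS]
  · simp [hS]

lemma onCycles_compl_mul (S : Finset (CycleIndex π)) : onCycles Sᶜ * onCycles S = π := by
  rw [← onCycles_union disjoint_compl_left, Finset.union_comm, Finset.union_compl]
  ext x
  simp [onCycles_apply]

lemma sign_onCycles_singleton (c : CycleIndex π) :
    Perm.sign (onCycles {c}) = -(-1) ^ (cyclePoints c).card := by
  obtain c | y := c
  · have hc : onCycles {Sum.inl c} = c.1 := by
      ext x
      simp only [onCycles_apply, Finset.mem_singleton, cycleIndex_eq_iff]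
      split_ifs with hx
      · exact ((Perm.mem_cycleFactorsFinset_iff.1 c.2).2 x hx).symm
      · exact (Perm.notMem_support.1 hx).symm
    rw [hc, (Perm.mem_cycleFactorsFinset_iff.1 c.2).1.sign]
    rfl
  · have hy : onCycles {Sum.inr y} = 1 := by
      ext x
      simp only [onCycles_apply, Finset.mem_singleton, cycleIndex_eq_iff]
      split_ifs with hx
      · rw [Finset.mem_singleton.1 hx, y.2, Perm.one_apply]
      · rfl
    simp [hy, cyclePoints]

lemma sign_onCycles (S : Finset (CycleIndex π)) :
    Perm.sign (onCycles S) = ∏ c ∈ S, -(-1) ^ (cyclePoints c).card := by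
  induction S using Finset.induction_on with
  | empty =>
    have h1 : onCycles (∅ : Finset (CycleIndex π)) = 1 := by
      ext x
      simp [onCycles_apply]
    rw [h1, map_one, Finset.prod_empty]
  | insert c S hc ih =>
    rw [Finset.insert_eq, onCycles_union (Finset.disjoint_singleton_left.2 hc), map_mul, ih,
      sign_onCycles_singleton, ← Finset.insert_eq, Finset.prod_insert hc]

lemma coeff_twistedSum_cycleUnion (S : Finset (CycleIndex π)) :
    (twistedSum 1 (permsOn (cycleUnion S)ᶜ) *
      twistedSum (signChar ℚ α) (permsOn (cycleUnion S))).coeff π = signChar ℚ α (onCycles S) := by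
  have h := coeff_twistedSum_mul_twistedSum 1 (signChar ℚ α)
    (disjoint_permsOn (disjoint_compl_left (a := cycleUnion S)))
    (cycleUnion_compl S ▸ onCycles_mem_permsOn Sᶜ) (onCycles_mem_permsOn S)
  rwa [onCycles_compl_mul, MonoidHom.one_apply, one_mul] at h

lemma coeff_twistedSum_mul_twistedSum_eq_zero {Z : Finset α}
    (h : ∀ S : Finset (CycleIndex π), cycleUnion S ≠ Z) :
    (twistedSum 1 (permsOn Zᶜ) * twistedSum (signChar ℚ α) (permsOn Z)).coeff π = 0 := by
  refine coeff_twistedSum_mul_twistedSum_of_notMem _ _ fun p hp hq => ?_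
  obtain ⟨S, hS⟩ := exists_cycleUnion_eq (π := π) (Z := Z) fun x => by
    have hpZ := apply_mem_iff_of_mem_permsOn hp (x := p⁻¹ (π x))
    have hqZ := apply_mem_iff_of_mem_permsOn hq (x := x)
    rw [Finset.mem_compl, Finset.mem_compl, ← Perm.mul_apply, mul_inv_cancel, Perm.one_apply,
      not_iff_not] at hpZ
    rw [hpZ, ← hqZ, Perm.mul_apply]
  exact h S hS

open Polynomial in
/-- Up to factorials, the coefficients are the characters of the exterior powers of the permutation
representation. -/
lemma sum_coeff_twistedSum_mul_twistedSum (π : Perm α) :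
    ∑ Z : Finset α, C ((twistedSum 1 (permsOn Zᶜ) *
        twistedSum (signChar ℚ α) (permsOn Z)).coeff π) * X ^ Z.card =
      (π.partition.parts.map fun b => 1 - (-X : ℚ[X]) ^ b).prod := by
  rw [← prod_card_cyclePoints]
  simp only [sub_eq_add_neg]
  rw [Finset.prod_one_add, Finset.powerset_univ]
  symm
  refine Finset.sum_of_injOn cycleUnion (cycleUnion_injective π).injOn
    (fun _ _ => Finset.mem_coe.2 (Finset.mem_univ _)) ?_ ?_
  · intro Z _ hZ
    rw [coeff_twistedSum_mul_twistedSum_eq_zero fun S hS => hZ ⟨S, by simp, hS⟩, C_0, zero_mul]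
  · intro S _
    rw [coeff_twistedSum_cycleUnion, signChar_apply, sign_onCycles, card_cycleUnion,
      ← Finset.prod_pow_eq_pow_sum]
    push_cast
    rw [map_prod, ← Finset.prod_mul_distrib]
    refine Finset.prod_congr rfl fun c _ => ?_
    rw [neg_pow (X : ℚ[X])]
    simp

end Cycles

section HookPolynomial

open Polynomial

/-- The quotient `∏ b ∈ m, (1 - X ^ b) / (1 - X)`. Its coefficients are, up to the sign `(-1) ^ k`,
the characters of the hooks with `k` boxes below the first row at the cycle type `m`. -/
def hookPolynomial (m : Multiset ℕ) : ℚ[X] :=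
  -((m.map fun b => 1 - (X : ℚ[X]) ^ b).prod /ₘ (X - C 1))

lemma one_sub_X_mul_hookPolynomial {m : Multiset ℕ} (hm : m ≠ 0) :
    (1 - X) * hookPolynomial m = (m.map fun b => 1 - (X : ℚ[X]) ^ b).prod := by
  have hroot : IsRoot (m.map fun b => 1 - (X : ℚ[X]) ^ b).prod 1 := by
    obtain ⟨b, hb⟩ := Multiset.exists_mem_of_ne_zero hm
    refine dvd_iff_isRoot.1 (Dvd.dvd.trans ?_ (Multiset.dvd_prod (Multiset.mem_map_of_mem _ hb)))
    exact dvd_iff_isRoot.2 (by simp)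
  rw [hookPolynomial, mul_neg, ← neg_mul, neg_sub]
  nth_rewrite 1 [← C_1]
  rw [mul_divByMonic_eq_iff_isRoot.2 hroot]

lemma one_sub_X_ne_zero : (1 - X : ℚ[X]) ≠ 0 := fun h => by
  simpa using congrArg (eval 0) h

lemma hookPolynomial_cons (b : ℕ) (m : Multiset ℕ) :
    hookPolynomial (b ::ₘ m) =
      (∑ k ∈ Finset.range b, X ^ k) * (m.map fun b => 1 - (X : ℚ[X]) ^ b).prod := by
  refine mul_left_cancel₀ one_sub_X_ne_zero ?_
  rw [one_sub_X_mul_hookPolynomial (Multiset.cons_ne_zero), Multiset.map_cons,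
    Multiset.prod_cons, ← mul_assoc, mul_neg_geom_sum]

lemma coeff_hookPolynomial_zero {m : Multiset ℕ} (hm : m ≠ 0) :
    (hookPolynomial m).coeff 0 = (m.map fun b => 1 - (X : ℚ[X]) ^ b).prod.coeff 0 := by
  rw [← one_sub_X_mul_hookPolynomial hm, sub_mul, one_mul, coeff_sub, coeff_X_mul_zero, sub_zero]

lemma coeff_hookPolynomial_succ {m : Multiset ℕ} (hm : m ≠ 0) (k : ℕ) :
    (hookPolynomial m).coeff (k + 1) - (hookPolynomial m).coeff k =
      (m.map fun b => 1 - (X : ℚ[X]) ^ b).prod.coeff (k + 1) := by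
  rw [← one_sub_X_mul_hookPolynomial hm, sub_mul, one_mul, coeff_sub, coeff_X_mul]

lemma natDegree_hookPolynomial_lt {m : Multiset ℕ} (hm : m.sum ≠ 0) :
    (hookPolynomial m).natDegree < m.sum := by
  have hprod : (m.map fun b => 1 - (X : ℚ[X]) ^ b).prod.natDegree ≤ m.sum := by
    refine (natDegree_multiset_prod_le _).trans ?_
    rw [Multiset.map_map]
    refine (Multiset.sum_map_le_sum_map _ id fun b _ => ?_).trans_eq (by rw [Multiset.map_id])
    exact (natDegree_sub_le _ _).trans (by simp)
  rw [hookPolynomial, natDegree_neg, natDegree_divByMonic _ (monic_X_sub_C 1), natDegree_X_sub_C]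
  omega

lemma coeff_hookPolynomial_singleton {d k : ℕ} (hk : k < d) :
    (hookPolynomial {d}).coeff k = 1 := by
  rw [← Multiset.cons_zero, hookPolynomial_cons, Multiset.map_zero, Multiset.prod_zero, mul_one,
    finsetSum_coeff]
  simp [coeff_X_pow, hk]

lemma eval_one_hookPolynomial {m : Multiset ℕ} (hm : m ≠ 0) :
    (hookPolynomial m).eval 1 = if m = {m.sum} then (m.sum : ℚ) else 0 := by
  obtain ⟨b, hb⟩ := Multiset.exists_mem_of_ne_zero hm
  obtain ⟨t, rfl⟩ := Multiset.exists_cons_of_mem hb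
  rw [hookPolynomial_cons, eval_mul, eval_multiset_prod, Multiset.map_map]
  obtain rfl | ht := eq_or_ne t 0
  · simp [eval_finsetSum]
  · obtain ⟨c, hc⟩ := Multiset.exists_mem_of_ne_zero ht
    have hne : b ::ₘ t ≠ {(b ::ₘ t).sum} := fun h => ht <| Multiset.card_eq_zero.1 <| by
      simpa using congrArg Multiset.card h
    rw [if_neg hne, Multiset.prod_eq_zero, mul_zero]
    exact Multiset.mem_map.2 ⟨c, hc, by simp⟩

end HookPolynomial

section HookTrace

open MonoidAlgebra Equiv

variable {α : Type*} [Fintype α] [DecidableEq α]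

lemma partition_parts_conj_inv (σ g : Perm α) :
    (g⁻¹ * σ⁻¹ * g).partition.parts = σ.partition.parts := by
  have hconj : IsConj (g⁻¹ * σ⁻¹ * g) σ := Perm.isConj_iff_cycleType_eq.2 <| by
    rw [← Perm.cycleType_inv σ, ← Perm.cycleType_conj (σ := σ⁻¹) (τ := g⁻¹), inv_inv]
  rw [Perm.partition_eq_of_isConj.1 hconj]

open Polynomial in
lemma sum_powersetCard_coeff_twistedSum_mul_twistedSum (σ : Perm α) (k : ℕ) :
    ∑ Z ∈ Finset.powersetCard k Finset.univ, (twistedSum 1 (permsOn Zᶜ) *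
        twistedSum (signChar ℚ α) (permsOn Z)).coeff σ =
      (-1) ^ k * (σ.partition.parts.map fun b => 1 - (X : ℚ[X]) ^ b).prod.coeff k := by
  have hcomp : (σ.partition.parts.map fun b => 1 - (-X : ℚ[X]) ^ b).prod =
      (σ.partition.parts.map fun b => 1 - (X : ℚ[X]) ^ b).prod.comp (C (-1) * X) := by
    simp [multiset_prod_comp, Multiset.map_map]
  have h := congrArg (fun p => p.coeff k)
    ((sum_coeff_twistedSum_mul_twistedSum σ).trans hcomp)
  rw [comp_C_mul_X_coeff, finsetSum_coeff, mul_comm] at h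
  simp only [coeff_C_mul_X_pow, eq_comm (a := k)] at h
  rw [← h, ← Finset.sum_filter, Finset.univ_filter_card_eq]

lemma sum_powersetCard_biregularTrace_of (σ : Perm α) (k : ℕ) :
    ∑ Z ∈ Finset.powersetCard k Finset.univ, biregularTrace ℚ (of ℚ _ σ)
        (twistedSum 1 (permsOn Zᶜ) * twistedSum (signChar ℚ α) (permsOn Z)) =
      (Fintype.card α)! * ((-1) ^ k *
        (σ.partition.parts.map fun b => 1 - (Polynomial.X : Polynomial ℚ) ^ b).prod.coeff k) := by
  simp_rw [biregularTrace_of]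
  rw [Finset.sum_comm]
  simp_rw [sum_powersetCard_coeff_twistedSum_mul_twistedSum, partition_parts_conj_inv]
  rw [Finset.sum_const, Finset.card_univ, Fintype.card_perm, nsmul_eq_mul]

lemma choose_mul_factorial_mul_factorial_card_compl {Z : Finset α} {o : α} (ho : o ∉ Z) :
    ((Fintype.card α).choose Z.card : ℚ) * Z.card ! * (Zᶜ.card * (Zᶜ.card - 1)!) =
      (Fintype.card α)! := by
  have hpos : Zᶜ.card ≠ 0 := Finset.card_ne_zero_of_mem (Finset.mem_compl.2 ho)
  rw [← Nat.choose_mul_factorial_mul_factorial Z.card_le_univ, ← Finset.card_compl,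
    ← Nat.mul_factorial_pred hpos]
  push_cast
  rfl

lemma choose_mul_card_compl_ne_zero {Z : Finset α} {o : α} (ho : o ∉ Z) :
    ((Fintype.card α).choose Z.card : ℚ) * Zᶜ.card ≠ 0 :=
  mul_ne_zero (Nat.cast_ne_zero.2 (Nat.choose_pos Z.card_le_univ).ne')
    (Nat.cast_ne_zero.2 (Finset.card_ne_zero_of_mem (Finset.mem_compl.2 ho)))

lemma choose_mul_biregularTrace_hookElement (σ : Perm α) {Z : Finset α} {o : α} (ho : o ∉ Z)
    {c : ℚ} (hc : ∀ (W : Finset α) (p : α), p ∉ W → W.card + 1 = Z.card →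
      biregularTrace ℚ (of ℚ _ σ) (hookElement W p) = c) :
    ((Fintype.card α).choose Z.card : ℚ) *
        (Zᶜ.card * biregularTrace ℚ (of ℚ _ σ) (hookElement Z o) + Z.card * c) =
      Fintype.card α * ((Fintype.card α)! * ((-1) ^ Z.card *
        (σ.partition.parts.map fun b =>
          1 - (Polynomial.X : Polynomial ℚ) ^ b).prod.coeff Z.card)) := by
  rw [← sum_powersetCard_biregularTrace_of, Finset.mul_sum]
  simp_rw [← sum_biregularTrace_hookElement]
  rw [Finset.sum_congr rfl fun W hW => ?_, Finset.sum_const, Finset.card_powersetCard,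
    Finset.card_univ, nsmul_eq_mul]
  have hWZ : W.card = Z.card := (Finset.mem_powersetCard.1 hW).2
  rw [Finset.sum_congr rfl fun p hp => biregularTrace_hookElement_congr _ hWZ
      (Finset.mem_compl.1 hp) ho,
    Finset.sum_congr rfl fun y hy => hc (W.erase y) y (Finset.notMem_erase y W)
      (by rw [Finset.card_erase_add_one hy, hWZ]),
    Finset.sum_const, Finset.sum_const, Finset.card_compl, Finset.card_compl, hWZ, nsmul_eq_mul,
    nsmul_eq_mul]

lemma biregularTrace_of_hookElement (σ : Perm α) {Z : Finset α} {o : α} (ho : o ∉ Z) :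
    biregularTrace ℚ (of ℚ _ σ) (hookElement Z o) =
      (Fintype.card α : ℚ) * (Zᶜ.card - 1)! * Z.card ! *
        ((-1) ^ Z.card * (hookPolynomial σ.partition.parts).coeff Z.card) := by
  have hparts : σ.partition.parts ≠ 0 := fun h => by
    have hsum := σ.partition.parts_sum
    rw [h, Multiset.sum_zero] at hsum
    exact (Fintype.card_pos_iff.2 ⟨o⟩).ne hsum
  induction hk : Z.card generalizing Z o with
  | zero =>
    have h := choose_mul_biregularTrace_hookElement σ ho (c := 0) fun W p _ hW => by omega
    have hf := choose_mul_factorial_mul_factorial_card_compl ho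
    refine mul_left_cancel₀ (choose_mul_card_compl_ne_zero ho) ?_
    rw [hk] at h hf ⊢
    rw [← coeff_hookPolynomial_zero hparts, ← hf] at h
    linear_combination h
  | succ k ih =>
    have h := choose_mul_biregularTrace_hookElement σ ho fun W p hp hW => by
      have hcard : Wᶜ.card - 1 = Zᶜ.card := by rw [Finset.card_compl, Finset.card_compl]; omega
      rw [ih hp (by omega), hcard]
    have hf := choose_mul_factorial_mul_factorial_card_compl ho
    have hpos : Zᶜ.card ≠ 0 := Finset.card_ne_zero_of_mem (Finset.mem_compl.2 ho)
    refine mul_left_cancel₀ (choose_mul_card_compl_ne_zero ho) ?_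
    rw [hk] at h hf ⊢
    rw [← coeff_hookPolynomial_succ hparts, ← hf, ← Nat.mul_factorial_pred hpos,
      Nat.factorial_succ] at h
    rw [Nat.factorial_succ]
    push_cast at h ⊢
    linear_combination h

end HookTrace

section YoungDiagram

variable {μ : YoungDiagram}

lemma zero_mem_of_mem {c : ℕ × ℕ} (h : c ∈ μ) : (0, 0) ∈ μ :=
  μ.up_left_mem (Nat.zero_le _) (Nat.zero_le _) h

lemma card_col_union_row (h : (0, 0) ∈ μ) :
    (μ.col 0 ∪ μ.row 0).card + 1 = μ.colLen 0 + μ.rowLen 0 := by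
  have hinter : μ.col 0 ∩ μ.row 0 = {(0, 0)} := by
    ext ⟨i, j⟩
    rw [Finset.mem_inter, YoungDiagram.mem_col_iff, YoungDiagram.mem_row_iff,
      Finset.mem_singleton, Prod.mk_inj]
    exact ⟨fun hij => ⟨hij.2.2, hij.1.2⟩, by rintro ⟨rfl, rfl⟩; exact ⟨⟨h, rfl⟩, h, rfl⟩⟩
  rw [YoungDiagram.colLen_eq_card, YoungDiagram.rowLen_eq_card,
    ← Finset.card_union_add_card_inter, hinter, Finset.card_singleton]

lemma col_union_row_subset : μ.col 0 ∪ μ.row 0 ⊆ μ.cells :=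
  Finset.union_subset (Finset.filter_subset _ _) (Finset.filter_subset _ _)

lemma colLen_add_rowLen_le_card (h : (1, 1) ∈ μ) : μ.colLen 0 + μ.rowLen 0 ≤ μ.card := by
  have hssubset : μ.col 0 ∪ μ.row 0 ⊂ μ.cells :=
    Finset.ssubset_iff_subset_ne.2 ⟨col_union_row_subset, fun heq => by
      have := heq ▸ (YoungDiagram.mem_cells _).2 h
      simp [YoungDiagram.mem_col_iff, YoungDiagram.mem_row_iff] at this⟩
  rw [← card_col_union_row (zero_mem_of_mem h)]
  exact Finset.card_lt_card hssubset

lemma eq_zero_or_eq_zero_of_mem (h : (1, 1) ∉ μ) {i j : ℕ} (hij : (i, j) ∈ μ) :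
    i = 0 ∨ j = 0 := by
  by_contra! hne
  exact h (μ.up_left_mem (Nat.one_le_iff_ne_zero.2 hne.1) (Nat.one_le_iff_ne_zero.2 hne.2) hij)

lemma colLen_add_rowLen_of_hook (h0 : (0, 0) ∈ μ) (h : (1, 1) ∉ μ) :
    μ.colLen 0 + μ.rowLen 0 = μ.card + 1 := by
  have heq : μ.col 0 ∪ μ.row 0 = μ.cells := col_union_row_subset.antisymm fun ⟨i, j⟩ hij => by
    rw [Finset.mem_union, YoungDiagram.mem_col_iff, YoungDiagram.mem_row_iff]
    exact (eq_zero_or_eq_zero_of_mem h hij).symm.imp (⟨hij, ·⟩) (⟨hij, ·⟩)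
  rw [← card_col_union_row h0, heq, YoungDiagram.card]

lemma rowLen_of_hook (h : (1, 1) ∉ μ) {i : ℕ} (hi : i ≠ 0) (hi' : i < μ.colLen 0) :
    μ.rowLen i = 1 := by
  have hpos : 0 < μ.rowLen i := by
    rwa [← YoungDiagram.mem_iff_lt_rowLen, YoungDiagram.mem_iff_lt_colLen]
  have hle : ¬ 1 < μ.rowLen i := by
    rw [← YoungDiagram.mem_iff_lt_rowLen]
    exact fun hmem => (eq_zero_or_eq_zero_of_mem h hmem).elim hi one_ne_zero
  omega

end YoungDiagram

section Tableau

open MonoidAlgebra Equiv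

variable {d : ℕ} {lam : d.Partition}

lemma row_lt (T : Tableau lam) (x : Fin d) : T.row x < (diagram lam).colLen 0 :=
  YoungDiagram.mem_iff_lt_colLen.1 ((diagram lam).up_left_mem le_rfl (Nat.zero_le _) (T.symm x).2)

lemma col_lt (T : Tableau lam) (x : Fin d) : T.col x < (diagram lam).rowLen 0 :=
  YoungDiagram.mem_iff_lt_rowLen.1 ((diagram lam).up_left_mem (Nat.zero_le _) le_rfl (T.symm x).2)

lemma youngSymmetrizer_eq_twistedSum_mul_twistedSum (T : Tableau lam) :
    youngSymmetrizer T =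
      twistedSum 1 (fiberPerms T.row) * twistedSum (signChar ℚ _) (fiberPerms T.col) := by
  simp only [youngSymmetrizer, rowSymmetrizer, colAntisymmetrizer, twistedSum, mem_fiberPerms,
    MonoidHom.one_apply, one_smul, signChar_apply]

lemma youngSymmetrizer_mul_mul_hookElement (T : Tableau lam) (h : (1, 1) ∈ diagram lam)
    {Z : Finset (Fin d)} {o : Fin d} (ho : o ∉ Z) (z : GroupAlg d) :
    youngSymmetrizer T * (z * hookElement Z o) = 0 := by
  have hle := (colLen_add_rowLen_le_card h).trans_eq (card_diagram lam)
  have hinsert : (insert o Z).card = Z.card + 1 := Finset.card_insert_of_notMem ho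
  have hcompl : Zᶜ.card + Z.card = d := by rw [Finset.card_compl_add_card, Fintype.card_fin]
  have hsign : ∀ x y : Fin d, x ≠ y → (1 : Perm (Fin d) →* ℚ) (swap x y) ≠
      signChar ℚ _ (swap x y) := fun x y hxy => by
    rw [signChar_swap hxy, MonoidHom.one_apply]
    norm_num
  rw [youngSymmetrizer_eq_twistedSum_mul_twistedSum, hookElement, mul_assoc]
  by_cases hY : (diagram lam).colLen 0 < (insert o Z).card
  · have := twistedSum_fiberPerms_mul_mul_twistedSum_permsOn hsign (row_lt T) hY
      (twistedSum (signChar ℚ _) (fiberPerms T.col) * z * twistedSum 1 (permsOn Zᶜ))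
    simpa only [mul_assoc] using this
  · have := twistedSum_fiberPerms_mul_mul_twistedSum_permsOn (fun x y hxy => (hsign x y hxy).symm)
      (col_lt T) (by omega : _ < Zᶜ.card) z
    rw [← mul_assoc z, ← mul_assoc (twistedSum (signChar ℚ _) _), this, zero_mul, mul_zero]

lemma exists_irrChar_eq_biregularTrace (lam : d.Partition) :
    ∃ e ∈ SpechtModule lam, ∀ σ, irrChar lam σ = biregularTrace ℚ (of ℚ _ σ) e :=
  let ⟨e, he, htrace⟩ := exists_trace_lsmul_eq_biregularTrace (k := ℚ) (SpechtModule lam)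
  ⟨e, he, fun σ => htrace (of ℚ _ σ)⟩

lemma irrChar_congr (lam : d.Partition) {σ τ : Perm (Fin d)}
    (h : σ.partition.parts = τ.partition.parts) : irrChar lam σ = irrChar lam τ := by
  obtain ⟨e, -, he⟩ := exists_irrChar_eq_biregularTrace lam
  obtain ⟨g, rfl⟩ := isConj_iff.1 (Perm.partition_eq_of_isConj.2 (Nat.Partition.ext h))
  rw [he, he, biregularTrace_of_conj]

lemma partition_parts_inv (σ : Perm (Fin d)) : σ⁻¹.partition.parts = σ.partition.parts := by
  simpa using partition_parts_conj_inv σ 1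

lemma sum_partition_parts (σ : Perm (Fin d)) : σ.partition.parts.sum = d := by
  rw [σ.partition.parts_sum, Fintype.card_fin]

lemma partition_parts_ne_zero (hd : d ≠ 0) (σ : Perm (Fin d)) : σ.partition.parts ≠ 0 :=
  fun h => hd <| by rw [← sum_partition_parts σ, h, Multiset.sum_zero]

lemma sum_irrChar_mul_coeff_hookPolynomial (h : (1, 1) ∈ diagram lam) {k : ℕ} (hk : k < d) :
    ∑ σ, irrChar lam σ * (hookPolynomial σ.partition.parts).coeff k = 0 := by
  obtain ⟨e, he, hirr⟩ := exists_irrChar_eq_biregularTrace lam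
  obtain ⟨a, rfl⟩ := Ideal.mem_span_singleton'.1 he
  obtain ⟨Z, hZ⟩ : ∃ Z : Finset (Fin d), Z.card = k :=
    (Finset.exists_subset_card_eq (s := Finset.univ) (by simpa using hk.le)).imp fun _ h => h.2
  obtain ⟨o, ho⟩ : ∃ o, o ∉ Z := by
    by_contra! hall
    rw [Finset.eq_univ_of_forall hall, Finset.card_univ, Fintype.card_fin] at hZ
    exact hk.ne' hZ
  have hzero := biregularTrace_eq_zero (k := ℚ)
    (z := a * youngSymmetrizer (someTableau lam)) (x := hookElement Z o) fun y => by
      rw [mul_assoc, youngSymmetrizer_mul_mul_hookElement _ h ho, mul_zero]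
  have hsum := sum_biregularTrace_of_mul_biregularTrace_of_inv
    (a * youngSymmetrizer (someTableau lam)) (hookElement Z o)
  rw [hzero, mul_zero] at hsum
  simp_rw [← hirr, biregularTrace_of_hookElement _ ho, partition_parts_inv, hZ] at hsum
  have hm : (Fintype.card (Fin d) : ℚ) * (Zᶜ.card - 1)! * k ! * (-1) ^ k ≠ 0 := by
    have : (d : ℚ) ≠ 0 := Nat.cast_ne_zero.2 (by omega)
    simp [this, Nat.factorial_ne_zero]
  refine (mul_eq_zero.1 (Eq.trans ?_ hsum)).resolve_left hm
  rw [Finset.mul_sum]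
  exact Finset.sum_congr rfl fun σ _ => by ring

theorem irrChar_eq_zero_of_partition_parts_eq_singleton (h : (1, 1) ∈ diagram lam)
    {σ : Perm (Fin d)} (hσ : σ.partition.parts = {d}) : irrChar lam σ = 0 := by
  have hd : d ≠ 0 := (σ.partition.parts_pos (hσ ▸ Multiset.mem_singleton_self d)).ne'
  have hzero : ∑ τ, irrChar lam τ * (hookPolynomial τ.partition.parts).eval 1 = 0 := by
    have heval : ∀ τ : Perm (Fin d), (hookPolynomial τ.partition.parts).eval 1 =
        ∑ k ∈ Finset.range d, (hookPolynomial τ.partition.parts).coeff k := fun τ => by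
      rw [Polynomial.eval_eq_sum_range' (n := d) <|
        (natDegree_hookPolynomial_lt (by rwa [sum_partition_parts])).trans_eq
          (sum_partition_parts τ)]
      simp only [one_pow, mul_one]
    simp_rw [heval, Finset.mul_sum]
    rw [Finset.sum_comm]
    exact Finset.sum_eq_zero fun k hk =>
      sum_irrChar_mul_coeff_hookPolynomial h (Finset.mem_range.1 hk)
  have hclass : ∀ τ : Perm (Fin d), irrChar lam τ * (hookPolynomial τ.partition.parts).eval 1 =
      irrChar lam σ * if τ.partition.parts = {d} then (d : ℚ) else 0 := fun τ => by
    rw [eval_one_hookPolynomial (partition_parts_ne_zero hd τ), sum_partition_parts]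
    split_ifs with hτ
    · rw [irrChar_congr lam (hτ.trans hσ.symm)]
    · simp only [mul_zero]
  simp_rw [hclass, ← Finset.mul_sum] at hzero
  refine (mul_eq_zero.1 hzero).resolve_right (ne_of_gt ?_)
  refine Finset.sum_pos' (fun τ _ => by positivity) ⟨σ, Finset.mem_univ _, ?_⟩
  rw [if_pos hσ]
  positivity

end Tableau

section Hook

open Equiv

variable {d : ℕ} {lam : d.Partition}

lemma zero_mem_diagram (hd : d ≠ 0) (lam : d.Partition) : (0, 0) ∈ diagram lam := by
  obtain ⟨c, hc⟩ := Finset.card_pos.1 ((card_diagram lam).symm ▸ Nat.pos_of_ne_zero hd)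
  exact zero_mem_of_mem hc

/-- The number of rows below the first one; for a hook, this is the length of its leg. -/
def legLength (lam : d.Partition) : ℕ := (diagram lam).colLen 0 - 1

lemma colLen_eq_legLength_add_one (hd : d ≠ 0) (lam : d.Partition) :
    (diagram lam).colLen 0 = legLength lam + 1 :=
  (Nat.sub_add_cancel (YoungDiagram.mem_iff_lt_colLen.1 (zero_mem_diagram hd lam))).symm

lemma rowLen_add_legLength (hd : d ≠ 0) (h : (1, 1) ∉ diagram lam) :
    (diagram lam).rowLen 0 + legLength lam = d := by
  have hcard := colLen_add_rowLen_of_hook (zero_mem_diagram hd lam) h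
  rw [YoungDiagram.card, card_diagram, colLen_eq_legLength_add_one hd] at hcard
  omega

lemma legLength_lt (hd : d ≠ 0) (h : (1, 1) ∉ diagram lam) : legLength lam < d := by
  have hsum := rowLen_add_legLength hd h
  have hpos := YoungDiagram.mem_iff_lt_rowLen.1 (zero_mem_diagram hd lam)
  omega

lemma card_filter_col (T : Tableau lam) (j : ℕ) :
    ({x | T.col x = j} : Finset (Fin d)).card = (diagram lam).colLen j := by
  rw [YoungDiagram.colLen_eq_card]
  exact Finset.card_bij' (fun x _ => (T.symm x).1)
    (fun c hc => T ⟨c, (YoungDiagram.mem_col_iff.1 hc).1⟩)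
    (fun x hx => YoungDiagram.mem_col_iff.2 ⟨(T.symm x).2, (Finset.mem_filter.1 hx).2⟩)
    (fun c hc => (Finset.mem_filter_univ _).2 <| by
      simpa [Tableau.col] using (YoungDiagram.mem_col_iff.1 hc).2)
    (fun x _ => by simp) fun c _ => by simp

lemma eq_of_row_eq_of_col_eq (T : Tableau lam) {x y : Fin d} (hrow : T.row x = T.row y)
    (hcol : T.col x = T.col y) : x = y :=
  T.symm.injective (Subtype.ext (Prod.ext hrow hcol))

lemma row_eq_zero_or_col_eq_zero (h : (1, 1) ∉ diagram lam) (T : Tableau lam) (x : Fin d) :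
    T.row x = 0 ∨ T.col x = 0 :=
  eq_zero_or_eq_zero_of_mem h (T.symm x).2

lemma exists_youngSymmetrizer_eq_hookElement (hd : d ≠ 0) (h : (1, 1) ∉ diagram lam)
    (T : Tableau lam) : ∃ (Z : Finset (Fin d)) (o : Fin d), o ∉ Z ∧ Z.card = legLength lam ∧
      youngSymmetrizer T = hookElement Z o := by
  have hcol : ∀ x, T.row x ≠ 0 → T.col x = 0 := fun x =>
    (row_eq_zero_or_col_eq_zero h T x).resolve_left
  have hrow : ∀ x, T.col x ≠ 0 → T.row x = 0 := fun x =>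
    (row_eq_zero_or_col_eq_zero h T x).resolve_right
  set o := T ⟨(0, 0), zero_mem_diagram hd lam⟩ with ho
  have hro : T.row o = 0 := by simp [ho, Tableau.row]
  have hco : T.col o = 0 := by simp [ho, Tableau.col]
  set Z : Finset (Fin d) := {x | T.row x ≠ 0} with hZ
  have hoZ : o ∉ Z := by simp [hZ, hro]
  have hZc : Zᶜ = ({x | T.row x = 0} : Finset (Fin d)) := by
    ext x
    simp [hZ]
  have hinsert : insert o Z = ({x | T.col x = 0} : Finset (Fin d)) := by
    ext x
    simp only [hZ, Finset.mem_insert, Finset.mem_filter_univ]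
    refine ⟨by rintro (rfl | hx); exacts [hco, hcol x hx], fun hx => ?_⟩
    exact or_iff_not_imp_right.2 fun hr => eq_of_row_eq_of_col_eq T
      ((not_not.1 hr).trans hro.symm) (hx.trans hco.symm)
  refine ⟨Z, o, hoZ, ?_, ?_⟩
  · rw [legLength, ← card_filter_col T, ← hinsert, Finset.card_insert_of_notMem hoZ,
      Nat.add_sub_cancel]
  · rw [youngSymmetrizer_eq_twistedSum_mul_twistedSum, hookElement, hZc, hinsert,
      fiberPerms_eq_permsOn, fiberPerms_eq_permsOn]
    · exact fun x hx y hy hxy =>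
        eq_of_row_eq_of_col_eq T ((hrow x hx).trans (hrow y hy).symm) hxy
    · exact fun x hx y hy hxy =>
        eq_of_row_eq_of_col_eq T hxy ((hcol x hx).trans (hcol y hy).symm)

theorem irrChar_of_hook (hd : d ≠ 0) (h : (1, 1) ∉ diagram lam) (σ : Perm (Fin d)) :
    irrChar lam σ =
      (-1) ^ legLength lam * (hookPolynomial σ.partition.parts).coeff (legLength lam) := by
  obtain ⟨Z, o, ho, hZ, hT⟩ := exists_youngSymmetrizer_eq_hookElement hd h (someTableau lam)
  have hm : (Fintype.card (Fin d) : ℚ) * (Zᶜ.card - 1)! * Z.card ! ≠ 0 := by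
    simp [hd, Nat.factorial_ne_zero]
  have htrace := trace_lsmul_span_singleton hm (hookElement_mul_self ho) (MonoidAlgebra.of ℚ _ σ)
  rw [biregularTrace_of_hookElement σ ho, inv_mul_cancel_left₀ hm, hZ, ← hT] at htrace
  exact htrace

lemma rowLens_diagram (lam : d.Partition) : (diagram lam).rowLens = lam.parts.sort (· ≥ ·) :=
  YoungDiagram.rowLens_ofRowLens_eq_self fun _ hx => lam.parts_pos ((Multiset.mem_sort _).1 hx)

lemma parts_eq_coe_rowLens (lam : d.Partition) : lam.parts = ↑(diagram lam).rowLens := by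
  rw [rowLens_diagram, Multiset.sort_eq]

lemma legLength_injOn (hd : d ≠ 0) :
    Set.InjOn (legLength (d := d)) {lam | (1, 1) ∉ diagram lam} := by
  intro lam h mu h' hleg
  have hcol : (diagram lam).colLen 0 = (diagram mu).colLen 0 := by
    rw [colLen_eq_legLength_add_one hd, colLen_eq_legLength_add_one hd, hleg]
  have hrow : (diagram lam).rowLen 0 = (diagram mu).rowLen 0 := by
    have := rowLen_add_legLength hd h
    have := rowLen_add_legLength hd h'
    omega
  refine Nat.Partition.ext ?_
  rw [parts_eq_coe_rowLens, parts_eq_coe_rowLens, YoungDiagram.rowLens, YoungDiagram.rowLens,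
    ← hcol]
  refine congrArg _ (List.map_congr_left fun i hi => ?_)
  rw [List.mem_range] at hi
  rcases eq_or_ne i 0 with rfl | hi0
  · exact hrow
  · rw [rowLen_of_hook h hi0 hi, rowLen_of_hook h' hi0 (hcol ▸ hi)]

lemma exists_legLength_eq {k : ℕ} (hk : k < d) :
    ∃ lam : d.Partition, (1, 1) ∉ diagram lam ∧ legLength lam = k := by
  set w : List ℕ := (d - k) :: List.replicate k 1 with hw
  have hmem : ∀ i ∈ w, 0 < i ∧ i ≤ d - k := fun i hi => by
    rcases List.mem_cons.1 hi with rfl | hi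
    · omega
    · rw [List.eq_of_mem_replicate hi]
      omega
  have hsorted : w.Pairwise (· ≥ ·) := List.pairwise_cons.2
    ⟨fun i hi => (hmem i (List.mem_cons_of_mem _ hi)).2, List.pairwise_replicate.2 (.inr le_rfl)⟩
  have hsum : (w : Multiset ℕ).sum = d := by
    rw [Multiset.sum_coe, hw, List.sum_cons, List.sum_replicate, smul_eq_mul]
    omega
  set lam : d.Partition := ⟨w, fun hi => (hmem _ hi).1, hsum⟩
  have hrowLens : (diagram lam).rowLens = w := by
    rw [rowLens_diagram, Multiset.coe_sort]
    exact List.mergeSort_of_pairwise (by simpa using hsorted)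
  have hcolLen : (diagram lam).colLen 0 = k + 1 := by
    rw [← YoungDiagram.length_rowLens, hrowLens, hw, List.length_cons, List.length_replicate]
  refine ⟨lam, fun h => ?_, by rw [legLength, hcolLen, Nat.add_sub_cancel]⟩
  have hlen : 1 < w.length := by
    rw [← hrowLens, YoungDiagram.length_rowLens, ← YoungDiagram.mem_iff_lt_colLen]
    exact (diagram lam).up_left_mem le_rfl (Nat.zero_le _) h
  have hrow : (diagram lam).rowLen 1 = w[1] := by
    simp only [← hrowLens, YoungDiagram.get_rowLens]
  have hlt := YoungDiagram.mem_iff_lt_rowLen.1 h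
  simp [hrow, hw] at hlt

lemma shiftedPowerSum_of_hook (hd : d ≠ 0) (h : (1, 1) ∉ diagram lam) (r : ℕ) :
    shiftedPowerSum r lam =
      ((d : ℚ) - legLength lam - 1 / 2) ^ r - (-(legLength lam + 1 / 2 : ℚ)) ^ r := by
  have hrow : ((diagram lam).rowLen 0 : ℚ) = d - legLength lam :=
    eq_sub_of_add_eq (by exact_mod_cast rowLen_add_legLength hd h)
  have hcol := colLen_eq_legLength_add_one hd lam
  have hterm : ∀ i ∈ Finset.range (legLength lam),
      (((diagram lam).rowLen (i + 1) : ℚ) - ((i + 1 : ℕ) + 1) + 1 / 2) ^ r -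
          (-((i + 1 : ℕ) + 1 : ℚ) + 1 / 2) ^ r =
        (-(i + 1 / 2 : ℚ)) ^ r - (-((i + 1 : ℕ) + 1 / 2 : ℚ)) ^ r := fun i hi => by
    rw [rowLen_of_hook h i.succ_ne_zero (hcol ▸ Nat.succ_lt_succ (Finset.mem_range.1 hi))]
    push_cast
    ring
  rw [shiftedPowerSum, hcol, Finset.sum_range_succ', Finset.sum_congr rfl hterm,
    Finset.sum_range_sub' fun i : ℕ => (-(i + 1 / 2 : ℚ)) ^ r, hrow]
  push_cast
  ring

/-- Only hooks contribute, since the characters of the other shapes vanish at long cycles. -/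
theorem sum_irrChar_mul_irrChar_of_long_cycle (hd : d ≠ 0) {c : Perm (Fin d)}
    (hc : c.partition.parts = {d}) (σ : Perm (Fin d)) (G : ℚ → ℚ) (r : ℕ) :
    ∑ lam : d.Partition, irrChar lam c * G (shiftedPowerSum r lam) * irrChar lam σ =
      ∑ k ∈ Finset.range d, (hookPolynomial σ.partition.parts).coeff k *
        G (((d : ℚ) - k - 1 / 2) ^ r - (-(k + 1 / 2 : ℚ)) ^ r) := by
  classical
  rw [← Finset.sum_filter_add_sum_filter_not Finset.univ
    (fun lam : d.Partition => (1, 1) ∈ diagram lam), Finset.sum_eq_zero, zero_add]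
  · refine Finset.sum_nbij legLength
      (fun lam hlam => Finset.mem_range.2 (legLength_lt hd (Finset.mem_filter.1 hlam).2))
      (fun lam h mu h' => legLength_injOn hd (Finset.mem_filter.1 h).2 (Finset.mem_filter.1 h').2)
      (fun k hk => ?_) fun lam hlam => ?_
    · obtain ⟨lam, h, hleg⟩ := exists_legLength_eq (Finset.mem_range.1 hk)
      exact ⟨lam, by simpa using h, hleg⟩
    · have h := (Finset.mem_filter.1 hlam).2
      rw [irrChar_of_hook hd h, irrChar_of_hook hd h, shiftedPowerSum_of_hook hd h, hc,
        coeff_hookPolynomial_singleton (legLength_lt hd h)]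
      linear_combination (hookPolynomial σ.partition.parts).coeff (legLength lam) *
        G (((d : ℚ) - legLength lam - 1 / 2) ^ r - (-(legLength lam + 1 / 2 : ℚ)) ^ r) *
        (pow_mul_pow_eq_one (a := (-1 : ℚ)) (b := -1) (legLength lam) (by norm_num))
  · intro lam hlam
    rw [irrChar_eq_zero_of_partition_parts_eq_singleton (Finset.mem_filter.1 hlam).2 hc, zero_mul,
      zero_mul]

end Hook

section Moments

open PowerSeries

/-- The power series `exp (a t)`. -/
def expSeries (a : ℚ) : ℚ⟦X⟧ := rescale a (exp ℚ)

lemma coeff_expSeries (a : ℚ) (j : ℕ) : coeff j (expSeries a) = a ^ j / j ! := by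
  simp [expSeries, coeff_rescale, coeff_exp, div_eq_mul_inv]

lemma expSeries_add (a b : ℚ) : expSeries (a + b) = expSeries a * expSeries b :=
  (exp_mul_exp_eq_exp_add a b).symm

lemma expSeries_zero : expSeries 0 = 1 := by simp [expSeries]

lemma expSeries_pow (a : ℚ) (j : ℕ) : expSeries a ^ j = expSeries (j * a) := by
  rw [expSeries, ← map_pow, exp_pow_eq_rescale_exp, rescale_rescale, expSeries]

/-- The power series `2 sinh (b t / 2) / t`. -/
def sinhSeries (b : ℚ) : ℚ⟦X⟧ :=
  mk fun j => ((b / 2) ^ (j + 1) - (-(b / 2)) ^ (j + 1)) / (j + 1)!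

lemma X_mul_sinhSeries (b : ℚ) :
    X * sinhSeries b = expSeries (b / 2) * (1 - expSeries (-b)) := by
  rw [mul_sub, mul_one, ← expSeries_add]
  ext j
  rw [map_sub, coeff_expSeries, coeff_expSeries]
  cases j with
  | zero => simp
  | succ j =>
    rw [coeff_succ_X_mul, sinhSeries, coeff_mk]
    ring

lemma coeff_zero_sinhSeries (b : ℚ) : coeff 0 (sinhSeries b) = b := by
  rw [sinhSeries, coeff_mk]
  norm_num

lemma coeff_zero_sinhSeries_mul (b : ℚ) (f : ℚ⟦X⟧) :
    coeff 0 (sinhSeries b * f) = b * coeff 0 f := by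
  rw [coeff_mul, Finset.Nat.antidiagonal_zero, Finset.sum_singleton, coeff_zero_sinhSeries]

lemma coeff_two_sinhSeries_mul (b : ℚ) (f : ℚ⟦X⟧) :
    coeff 2 (sinhSeries b * f) = b * coeff 2 f + b ^ 3 / 24 * coeff 0 f := by
  have hone : coeff 1 (sinhSeries b) = 0 := by
    rw [sinhSeries, coeff_mk]
    ring
  have htwo : coeff 2 (sinhSeries b) = b ^ 3 / 24 := by
    rw [sinhSeries, coeff_mk]
    norm_num [Nat.factorial]
    ring
  rw [coeff_mul, Finset.Nat.sum_antidiagonal_eq_sum_range_succ_mk, Finset.sum_range_succ,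
    Finset.sum_range_succ, Finset.sum_range_one, coeff_zero_sinhSeries, hone, htwo, zero_mul,
    add_zero, Nat.sub_zero, Nat.sub_self]

lemma coeff_zero_prod_sinhSeries (m : Multiset ℕ) :
    coeff 0 (m.map fun b : ℕ => sinhSeries b).prod = m.prod := by
  induction m using Multiset.induction_on with
  | empty => simp
  | cons b m ih =>
    rw [Multiset.map_cons, Multiset.prod_cons, Multiset.prod_cons, coeff_zero_sinhSeries_mul, ih,
      Nat.cast_mul]

lemma coeff_two_prod_sinhSeries (m : Multiset ℕ) :
    coeff 2 (m.map fun b : ℕ => sinhSeries b).prod =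
      m.prod * (m.map fun b : ℕ => (b : ℚ) ^ 2).sum / 24 := by
  induction m using Multiset.induction_on with
  | empty => simp [coeff_one]
  | cons b m ih =>
    rw [Multiset.map_cons, Multiset.prod_cons, coeff_two_sinhSeries_mul, ih,
      coeff_zero_prod_sinhSeries, Multiset.prod_cons, Multiset.map_cons, Multiset.sum_cons,
      Nat.cast_mul]
    ring

/-- The exponential generating function of the moments of the coefficients of `hookPolynomial m`
about the centre `(m.sum - 1) / 2` of their symmetry. -/
def momentSeries (m : Multiset ℕ) : ℚ⟦X⟧ :=
  expSeries (((m.sum : ℚ) - 1) / 2) * Polynomial.aeval (expSeries (-1)) (hookPolynomial m)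

lemma factorial_mul_coeff_momentSeries {m : Multiset ℕ} (hm : m.sum ≠ 0) (j : ℕ) :
    j ! * coeff j (momentSeries m) =
      ∑ k ∈ Finset.range m.sum,
        (hookPolynomial m).coeff k * (((m.sum : ℚ) - 1) / 2 - k) ^ j := by
  rw [momentSeries, Polynomial.aeval_eq_sum_range' (natDegree_hookPolynomial_lt hm),
    Finset.mul_sum, map_sum, Finset.mul_sum]
  refine Finset.sum_congr rfl fun k _ => ?_
  have hj : (j ! : ℚ) ≠ 0 := Nat.cast_ne_zero.2 j.factorial_ne_zero
  rw [mul_smul_comm, expSeries_pow, ← expSeries_add, mul_neg_one, ← sub_eq_add_neg, coeff_smul,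
    coeff_expSeries, smul_eq_mul]
  field_simp

lemma prod_X_mul_sinhSeries (m : Multiset ℕ) :
    (m.map fun b : ℕ => X * sinhSeries b).prod =
      expSeries (m.sum / 2) * (m.map fun b => 1 - expSeries (-1) ^ b).prod := by
  induction m using Multiset.induction_on with
  | empty => simp [expSeries_zero]
  | cons b m ih =>
    rw [Multiset.map_cons, Multiset.prod_cons, ih, X_mul_sinhSeries, Multiset.map_cons,
      Multiset.prod_cons, Multiset.sum_cons, Nat.cast_add, add_div, expSeries_add, expSeries_pow,
      mul_neg_one]
    ring

lemma X_mul_sinhSeries_mul_momentSeries {m : Multiset ℕ} (hm : m ≠ 0) :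
    X * (sinhSeries 1 * momentSeries m) =
      X ^ m.card * (m.map fun b : ℕ => sinhSeries b).prod := by
  have hprod := congrArg (Polynomial.aeval (expSeries (-1))) (one_sub_X_mul_hookPolynomial hm)
  rw [map_mul, map_sub, map_one, Polynomial.aeval_X, map_multiset_prod, Multiset.map_map] at hprod
  simp only [Function.comp_def, map_sub, map_one, map_pow, Polynomial.aeval_X] at hprod
  calc X * (sinhSeries 1 * momentSeries m)
      = expSeries (1 / 2) * expSeries (((m.sum : ℚ) - 1) / 2) *
          ((1 - expSeries (-1)) * Polynomial.aeval (expSeries (-1)) (hookPolynomial m)) := by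
        rw [← mul_assoc, X_mul_sinhSeries, momentSeries]
        ring
    _ = expSeries (m.sum / 2) * (m.map fun b => 1 - expSeries (-1) ^ b).prod := by
        rw [hprod, ← expSeries_add]
        congr 2
        ring
    _ = X ^ m.card * (m.map fun b : ℕ => sinhSeries b).prod := by
        rw [← prod_X_mul_sinhSeries, Multiset.prod_map_mul, Multiset.map_const',
          Multiset.prod_replicate]

lemma exists_momentSeries_eq_X_pow_mul {m : Multiset ℕ} {n : ℕ} (hm : m.card = n + 1) :
    ∃ f, momentSeries m = X ^ n * f ∧
      sinhSeries 1 * f = (m.map fun b : ℕ => sinhSeries b).prod := by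
  have hunit : constantCoeff (sinhSeries 1) ≠ 0 := by
    rw [← coeff_zero_eq_constantCoeff_apply, coeff_zero_sinhSeries]
    exact one_ne_zero
  have hne : sinhSeries 1 ≠ 0 := fun h => hunit (by rw [h, map_zero])
  have hf : sinhSeries 1 * ((sinhSeries 1)⁻¹ * (m.map fun b : ℕ => sinhSeries b).prod) =
      (m.map fun b : ℕ => sinhSeries b).prod := by
    rw [← mul_assoc, PowerSeries.mul_inv_cancel _ hunit, one_mul]
  refine ⟨_, mul_left_cancel₀ hne (mul_left_cancel₀ X_ne_zero ?_), hf⟩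
  rw [X_mul_sinhSeries_mul_momentSeries (Multiset.card_pos.1 (by omega)), hm, pow_succ',
    mul_left_comm (sinhSeries 1), hf, mul_assoc]

section CoeffMomentSeries

variable {m : Multiset ℕ} {n : ℕ}

lemma coeff_momentSeries_of_lt (hm : m.card = n + 1) {j : ℕ} (hj : j < n) :
    coeff j (momentSeries m) = 0 := by
  obtain ⟨f, hf, -⟩ := exists_momentSeries_eq_X_pow_mul hm
  rw [hf, coeff_X_pow_mul', if_neg hj.not_ge]

lemma coeff_momentSeries (hm : m.card = n + 1) : coeff n (momentSeries m) = m.prod := by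
  obtain ⟨f, hf, hprod⟩ := exists_momentSeries_eq_X_pow_mul hm
  rw [hf, coeff_X_pow_mul', if_pos le_rfl, Nat.sub_self, ← coeff_zero_prod_sinhSeries, ← hprod,
    coeff_zero_sinhSeries_mul, one_mul]

lemma coeff_add_two_momentSeries (hm : m.card = n + 1) :
    coeff (n + 2) (momentSeries m) = m.prod * ((m.map fun b : ℕ => (b : ℚ) ^ 2).sum - 1) / 24 := by
  obtain ⟨f, hf, hprod⟩ := exists_momentSeries_eq_X_pow_mul hm
  have hzero : coeff 0 f = m.prod := by
    rw [← coeff_zero_prod_sinhSeries, ← hprod, coeff_zero_sinhSeries_mul, one_mul]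
  have htwo := coeff_two_prod_sinhSeries m
  rw [← hprod, coeff_two_sinhSeries_mul, hzero] at htwo
  rw [hf, coeff_X_pow_mul', if_pos (Nat.le_add_right _ _), Nat.add_sub_cancel_left]
  linear_combination htwo

end CoeffMomentSeries

lemma sum_mul_add_mul_sq_pow {ι R : Type*} [CommRing R] {t : ℕ} {s : Finset ι} {v x : ι → R}
    (A B : R) (h : ∀ j < 2 * t, ∑ k ∈ s, v k * x k ^ j = 0) :
    ∑ k ∈ s, v k * (A + B * x k ^ 2) ^ (t + 1) =
      (t + 1) * A * B ^ t * ∑ k ∈ s, v k * x k ^ (2 * t) +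
        B ^ (t + 1) * ∑ k ∈ s, v k * x k ^ (2 * t + 2) := by
  have hbinom : ∀ k ∈ s, v k * (A + B * x k ^ 2) ^ (t + 1) =
      ∑ j ∈ Finset.range (t + 2), (B ^ j * A ^ (t + 1 - j) * (t + 1).choose j) *
        (v k * x k ^ (2 * j)) := fun k _ => by
    rw [add_comm A, add_pow, Finset.mul_sum]
    refine Finset.sum_congr rfl fun j _ => ?_
    rw [mul_pow, ← pow_mul]
    ring
  rw [Finset.sum_congr rfl hbinom, Finset.sum_comm]
  simp_rw [← Finset.mul_sum]
  rw [Finset.sum_range_succ, Finset.sum_range_succ, Finset.sum_eq_zero fun j hj => by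
    rw [h (2 * j) (by have := Finset.mem_range.1 hj; omega), mul_zero]]
  rw [zero_add, Nat.choose_self, Nat.sub_self, Nat.choose_succ_self_right,
    Nat.add_sub_cancel_left, mul_add_one 2 t]
  push_cast
  ring

end Moments

section OnePartHurwitz

variable {n : ℕ} {β : Fin n → ℕ}

lemma partitionOf_parts (hβ : ∀ i, 0 < β i) :
    (partitionOf β).parts = Finset.univ.val.map β := by
  change (Finset.univ.val.map β).filter (· ≠ 0) = _
  refine Multiset.filter_eq_self.2 fun b hb => ?_
  obtain ⟨i, -, rfl⟩ := Multiset.mem_map.1 hb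
  exact (hβ i).ne'

/-- The cubic shifted power sum of the hook with leg `k` is, up to the factor `3!`, quadratic in
the distance of `k` to the centre `(d - 1) / 2`. -/
lemma hook_power_sum_div_factorial (d k : ℚ) :
    ((d - k - 1 / 2) ^ (2 + 1) - (-(k + 1 / 2)) ^ (2 + 1)) / (2 + 1)! =
      d ^ 3 / 24 + d / 2 * ((d - 1) / 2 - k) ^ 2 := by
  norm_num [Nat.factorial]
  ring

theorem sum_mul_onePartHurwitz (g : ℕ) (hβ : ∀ i, 0 < β i) {d : ℕ} (hd : d = ∑ i, β i)
    (hd0 : d ≠ 0) :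
    d * onePartHurwitz g β = (∏ i, (β i : ℚ))⁻¹ *
      ∑ k ∈ Finset.range d, (hookPolynomial (Finset.univ.val.map β)).coeff k *
        ((d : ℚ) ^ 3 / 24 + d / 2 * (((d : ℚ) - 1) / 2 - k) ^ 2) ^ ((2 * g + n - 1) / 2) := by
  subst hd
  have hparts := partitionOf_parts hβ
  have hlong := Nat.Partition.indiscrete_parts hd0
  have hprod : ((partitionOf β).parts.prod : ℚ) = ∏ i, (β i : ℚ) := by
    rw [hparts]
    exact_mod_cast rfl
  have hs : numCycles g 2 (Nat.Partition.indiscrete _) (partitionOf β) = (2 * g + n - 1) / 2 := by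
    rw [numCycles, hlong, hparts, Multiset.card_singleton, Multiset.card_map, Finset.card_val,
      Finset.card_fin]
    omega
  have hσ := (exists_perm (partitionOf β)).choose_spec.trans hparts
  have hsum := sum_irrChar_mul_irrChar_of_long_cycle hd0
    ((exists_perm (Nat.Partition.indiscrete _)).choose_spec.trans hlong)
    (exists_perm (partitionOf β)).choose (fun p => (p / (2 + 1)!) ^ ((2 * g + n - 1) / 2)) (2 + 1)
  simp only [hook_power_sum_div_factorial, hσ] at hsum
  rw [onePartHurwitz, hurwitz, hs, hprod, hlong, Multiset.prod_singleton, ← hsum]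
  have hd' : ((∑ i, β i : ℕ) : ℚ) ≠ 0 := Nat.cast_ne_zero.2 hd0
  simp only [chi]
  field_simp

theorem sum_mul_onePartHurwitz_one {t : ℕ} {β : Fin (2 * t + 1) → ℕ} (hβ : ∀ i, 0 < β i) {d : ℕ}
    (hd : d = ∑ i, β i) :
    d * onePartHurwitz 1 β =
      (t + 1) * ((d : ℚ) ^ 3 / 24) * ((d : ℚ) / 2) ^ t * (2 * t)! +
        ((d : ℚ) / 2) ^ (t + 1) * ((2 * t + 2)! * ((∑ i, (β i : ℚ) ^ 2 - 1) / 24)) := by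
  have hd0 : d ≠ 0 := (hd.trans_gt (Finset.sum_pos (fun i _ => hβ i) Finset.univ_nonempty)).ne'
  set m := Finset.univ.val.map β with hm
  have hcard : m.card = 2 * t + 1 := by
    rw [hm, Multiset.card_map, Finset.card_val, Finset.card_fin]
  have hsum : m.sum = d := hd.symm
  have hprod : (m.prod : ℚ) = ∏ i, (β i : ℚ) := by
    rw [hm]
    exact_mod_cast rfl
  have hsq : (m.map fun b : ℕ => (b : ℚ) ^ 2).sum = ∑ i, (β i : ℚ) ^ 2 := by
    rw [hm, Multiset.map_map]
    rfl
  have hmoment := factorial_mul_coeff_momentSeries (hsum.trans_ne hd0)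
  rw [hsum] at hmoment
  have hne : ∏ i, (β i : ℚ) ≠ 0 :=
    Finset.prod_ne_zero_iff.2 fun i _ => Nat.cast_ne_zero.2 (hβ i).ne'
  rw [sum_mul_onePartHurwitz 1 hβ hd hd0, ← hm,
    show (2 * 1 + (2 * t + 1) - 1) / 2 = t + 1 by omega, sum_mul_add_mul_sq_pow _ _ fun j hj => by
      rw [← hmoment, coeff_momentSeries_of_lt hcard hj, mul_zero],
    ← hmoment, ← hmoment, coeff_momentSeries hcard, coeff_add_two_momentSeries hcard, hprod, hsq]
  field_simp

end OnePartHurwitz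

section HurwitzPolynomial

open MvPolynomial

lemma IsHurwitzPolynomial.unique {g n : ℕ} {P Q : MvPolynomial (Fin n) ℚ}
    (hP : IsHurwitzPolynomial g P) (hQ : IsHurwitzPolynomial g Q) : P = Q := by
  refine funext_set (fun _ => Set.range fun m : ℕ => ((m + 1 : ℕ) : ℚ)) (fun _ => ?_) fun x hx => ?_
  · exact Set.infinite_range_of_injective (Nat.cast_injective.comp Nat.succ_injective)
  · choose β hβ using fun i => hx i (Set.mem_univ i)
    obtain rfl : (fun i => ((β i + 1 : ℕ) : ℚ)) = x := funext hβ
    rw [hP (fun i => β i + 1) fun i => Nat.succ_pos _,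
      hQ (fun i => β i + 1) fun i => Nat.succ_pos _]

lemma IsHurwitzPolynomial.hurwitzPolynomial_eq {g n : ℕ} {P : MvPolynomial (Fin n) ℚ}
    (hP : IsHurwitzPolynomial g P) : hurwitzPolynomial g n = P := by
  have hex : ∃ P : MvPolynomial (Fin n) ℚ, IsHurwitzPolynomial g P := ⟨P, hP⟩
  rw [hurwitzPolynomial, dif_pos hex]
  exact hex.choose_spec.unique hP

/-- The genus one Hurwitz polynomial in `2 t + 1` variables, in closed form. -/
def genusOnePolynomial (t : ℕ) : MvPolynomial (Fin (2 * t + 1)) ℚ :=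
  C (((2 * t + 2)! : ℚ) / (24 * 2 ^ (t + 1) * (t + 1)!)) *
    (C (1 / (2 * t + 1 : ℚ)) * (∑ i, X i) ^ (t + 3) +
      ((∑ i, (∑ j, X j) ^ (t + 1) * X i ^ 2) - (∑ i, X i) ^ (t + 1)))

lemma isHurwitzPolynomial_genusOnePolynomial (t : ℕ) :
    IsHurwitzPolynomial 1 (genusOnePolynomial t) := by
  intro β hβ
  rw [sum_mul_onePartHurwitz_one hβ rfl, show 1 + (2 * t + 1 - 1) / 2 = t + 1 by omega]
  have hfactorial : ((2 * t + 2)! : ℚ) = (2 * t + 2) * ((2 * t + 1) * (2 * t)!) := by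
    rw [Nat.factorial_succ, Nat.factorial_succ]
    push_cast
    ring
  have hne : (2 * t + 1 : ℚ) ≠ 0 := by positivity
  simp only [genusOnePolynomial, map_mul, map_add, map_sub, map_pow, map_sum, eval_C, eval_X,
    ← Finset.mul_sum, Nat.cast_sum, hfactorial, div_pow]
  field_simp
  ring

variable {n : ℕ} {b : Fin n → ℕ}

lemma coeff_sum_X_pow (b : Fin n → ℕ) (m : ℕ) :
    coeff (Finsupp.equivFunOnFinite.symm b) ((∑ i, X i : MvPolynomial (Fin n) ℚ) ^ m) =
      if ∑ i, b i = m then (Nat.multinomial Finset.univ b : ℚ) else 0 := by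
  rw [coeff_sum_X_pow_of_fintype, Finsupp.sum_fintype _ _ fun _ => rfl,
    Finsupp.multinomial_eq_of_support_subset (Finset.subset_univ _)]
  simp

lemma equivFunOnFinite_symm_sub_single (i : Fin n) (c : ℕ) :
    Finsupp.equivFunOnFinite.symm b - Finsupp.single i c =
      Finsupp.equivFunOnFinite.symm (Function.update b i (b i - c)) := by
  ext j
  rcases eq_or_ne j i with rfl | hj
  · simp
  · simp [hj]

lemma coeff_sum_X_pow_mul_X_pow {m c : ℕ} (hb : ∑ i, b i = m + c) (i : Fin n) :
    coeff (Finsupp.equivFunOnFinite.symm b)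
      ((∑ j, X j : MvPolynomial (Fin n) ℚ) ^ m * X i ^ c) =
      if c ≤ b i then (Nat.multinomial Finset.univ (Function.update b i (b i - c)) : ℚ)
      else 0 := by
  rw [X_pow_eq_monomial, coeff_mul_monomial']
  by_cases hc : c ≤ b i
  · have hsum : ∑ j, Function.update b i (b i - c) j = m := by
      rw [Finset.sum_update_of_mem (Finset.mem_univ i), Finset.sdiff_singleton_eq_erase]
      rw [← Finset.add_sum_erase _ _ (Finset.mem_univ i)] at hb
      omega
    rw [if_pos (Finsupp.single_le_iff.2 hc), if_pos hc, mul_one, equivFunOnFinite_symm_sub_single,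
      coeff_sum_X_pow, if_pos hsum]
  · rw [if_neg fun h => hc (Finsupp.single_le_iff.1 h), if_neg hc]

theorem coeff_genusOnePolynomial {t : ℕ} {b : Fin (2 * t + 1) → ℕ} (hb : ∑ i, b i = t + 3) :
    (genusOnePolynomial t).coeff (Finsupp.equivFunOnFinite.symm b) =
      ((2 * t + 2)! : ℚ) / (24 * 2 ^ (t + 1) * (t + 1)!) *
        (1 / (2 * t + 1 : ℚ) * (Nat.multinomial Finset.univ b : ℚ) +
          ∑ i, if 2 ≤ b i then
            (Nat.multinomial Finset.univ (Function.update b i (b i - 2)) : ℚ)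
          else 0) := by
  have hsq := coeff_sum_X_pow_mul_X_pow (m := t + 1) (c := 2) hb
  rw [genusOnePolynomial, coeff_C_mul, coeff_add, coeff_sub, coeff_C_mul, coeff_sum,
    coeff_sum_X_pow, coeff_sum_X_pow, if_pos hb, if_neg (by omega), sub_zero]
  simp only [hsq]

end HurwitzPolynomial

end CompletedHurwitz

end

theorem corollary4p5 (n : ℕ) (hn : Odd n) :
    (∃! P : MvPolynomial (Fin n) ℚ, CompletedHurwitz.IsHurwitzPolynomial 1 P) ∧
    ∀ b : Fin n → ℕ, ∑ i, b i = (n + 5) / 2 →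
      CompletedHurwitz.topTerm 1 b =
        ((n + 1)! : ℚ) / (3 * 2 ^ ((n + 7) / 2) * (((n + 1) / 2)! : ℚ)) *
          (1 / (n : ℚ) * (Nat.multinomial Finset.univ b : ℚ) +
            ∑ i, if 2 ≤ b i then
              (Nat.multinomial Finset.univ (Function.update b i (b i - 2)) : ℚ)
            else 0) := by
  obtain ⟨t, rfl⟩ := hn
  have hP := CompletedHurwitz.isHurwitzPolynomial_genusOnePolynomial t
  refine ⟨⟨_, hP, fun Q hQ => hQ.unique hP⟩, fun b hb => ?_⟩
  have hb' : ∑ i, b i = t + 3 := by omega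
  rw [CompletedHurwitz.topTerm, CompletedHurwitz.combHodge, if_pos (by omega),
    hP.hurwitzPolynomial_eq, CompletedHurwitz.coeff_genusOnePolynomial hb', pow_zero, one_mul,
    show (2 * t + 1 + 7) / 2 = t + 1 + 3 by omega, show (2 * t + 1 + 1) / 2 = t + 1 by omega]
  push_cast
  rw [pow_add _ (t + 1) 3]
  congr 2
  ring
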